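/- **Theorem 1.1 (Existence and uniqueness).** Let $N\ge 1$, let $e_1,\dots,e_N$ be pairwise distinct unit vectors of $\mathbb R^2$, and put $J_i=[0,\infty)e_i$, $J_i^*=J_i\setminus\{0\}$, $J=\bigcup_{i=1}^N J_i$. Equip $J$ with the geodesic distance $d(x,y)=|x-y|$ if $x,y$ lie on a common branch $J_i$, and $d(x,y)=|x|+|y|$ otherwise. Let $T>0$ and $J_T=(0,T)\times J$. Assume: * (A0) $u_0\colon J\to\mathbb R$ is Lipschitz continuous; * (A1) there are $\gamma>0$ and functions $L_1,\dots,L_N\in C^2(\mathbb R)$ with $L_i''\ge\gamma$ such that, for all $i$ and $p$, $H_i(p)=\sup_{q\in\mathbb R}(pq-L_i(q))$ and $H_i^-(p)=\sup_{q\le 0}(pq-L_i(q))$. Consider the problem $$ \begin{cases} u_t+H_i(u^i_x)=0 & \text{on } (0,T)\times J_i^*,\quad i=1,\dots,N,\\ u_t+\max_{i=1,\dots,N}H_i^-(u^i_x)=0 & \text{on } (0,T)\times\{0\}, \end{cases} \qquad u(0,x)=u_0(x),\quad x\in J, \tag{P} $$ where $u^i_x$ is the derivative of $u$ with respect to the coordinate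 $r\ge 0$ of $x=re_i\in J_i$ (one-sided at $r=0$). A test function is a continuous $\phi\colon J_T\to\mathbb R$ whose restriction to each $(0,T)\times J_i$ is $C^1$ (up to $x=0$). A function $u\colon[0,T)\times J\to\mathbb R$ is a sub-solution (resp. super-solution) of the equations in (P) if it is upper (resp. lower) semi-continuous and, whenever $\phi$ is a test function such that $u\le\phi$ (resp. $u\ge\phi$) near some $(t,x)\in J_T$ with equality at $(t,x)$, one has at $(t,x)$ $$\phi_t+H_i(\phi^i_x)\le 0\ (\text{resp. }\ge 0)\ \text{ if } x\in J_i^*,\qquad \phi_t+\max_i H_i^-(\phi^i_x)\le 0\ (\text{resp. }\ge 0)\ \text{ if } x=0 .$$ A function $u\colon[0,T)\times J\to\mathbb R$ is a viscosity solution of (P) if its upper semi-continuous envelope $u^*$ is (finite and) a sub-solution with $u^*(0,\cdot)\le u_0$, and its lower semi-continuous envelope $u_*$ is (finite and) a super-solution with $u_*(0,\cdot)\ge u_0$. Then there exists a unique viscosity solution $u\colon[0,T)\times J\to\mathbb R$ of (P) such that, for some constant $C_T>0$, $$|u(t,x)-u_0(x)|\le C_T\qquad\text{for all }(t,x)\in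 J_T .$$ Moreover $u$ is Lipschitz continuous with respect to $(t,x)$ on $J_T$. -/

import Mathlib

open Set Filter Topology

namespace Junction

noncomputable section

/-- The Euclidean plane in which the junction is embedded. -/
abbrev Plane : Type := EuclideanSpace ℝ (Fin 2)

variable {N : ℕ}

/-- The branch `J_i = [0, ∞) · e_i`. -/
def branch (e : Fin N → Plane) (i : Fin N) : Set Plane :=
  {x | ∃ r : ℝ, 0 ≤ r ∧ x = r • e i}

/-- The junction `J`, the union of the branches. -/
def junction (e : Fin N → Plane) : Set Plane := ⋃ i, branch e i

open Classical in
/-- The geodesic distance on the junction. -/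
def geodDist (e : Fin N → Plane) (x y : Plane) : ℝ :=
  if ∃ i, x ∈ branch e i ∧ y ∈ branch e i then ‖x - y‖ else ‖x‖ + ‖y‖

/-- The set `J_T = (0, T) × J`. -/
def openCyl (e : Fin N → Plane) (T : ℝ) : Set (ℝ × Plane) := Ioo 0 T ×ˢ junction e

/-- The set `[0, T) × J`. -/
def cyl (e : Fin N → Plane) (T : ℝ) : Set (ℝ × Plane) := Ico 0 T ×ˢ junction e

/-- The Hamiltonian `H(p) = sup_q (p q - L(q))`, the Legendre-Fenchel transform of `L`. -/
def ham (L : ℝ → ℝ) (p : ℝ) : ℝ := ⨆ q : ℝ, (p * q - L q)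

/-- The function `H⁻(p) = sup_{q ≤ 0} (p q - L(q))`. -/
def hamNeg (L : ℝ → ℝ) (p : ℝ) : ℝ := ⨆ q : Iic (0 : ℝ), (p * (q : ℝ) - L q)

/-- The class `C¹_*(J_T)`: continuous on `J_T`, and of class `C¹` on each `(0, T) × J_i`, up to
the junction point, in the coordinates `(t, r) ↦ (t, r e_i)`. Only the values on `J_T` matter. -/
structure IsTest (e : Fin N → Plane) (T : ℝ) (φ : ℝ × Plane → ℝ) : Prop where
  continuousOn : ContinuousOn φ (openCyl e T)
  contDiffOn : ∀ i, ContDiffOn ℝ 1 (fun p : ℝ × ℝ => φ (p.1, p.2 • e i)) (Ioo 0 T ×ˢ Ici 0)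

/-- The time derivative `φ_t(t, x)`. -/
def timeDeriv (φ : ℝ × Plane → ℝ) (t : ℝ) (x : Plane) : ℝ := deriv (fun s => φ (s, x)) t

/-- The derivative `φ^i_x(t, r e_i)` along the branch `J_i`; it is one-sided at `r = 0`. -/
def branchDeriv (e : Fin N → Plane) (φ : ℝ × Plane → ℝ) (i : Fin N) (t r : ℝ) : ℝ :=
  derivWithin (fun ρ : ℝ => φ (t, ρ • e i)) (Ici 0) r

/-- `u ≤ φ` in a neighbourhood of `P` in `J_T`, with equality at `P`. -/
def TouchesFromAbove (e : Fin N → Plane) (T : ℝ) (φ u : ℝ × Plane → ℝ) (P : ℝ × Plane) : Prop :=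
  (∀ᶠ Q in 𝓝[openCyl e T] P, u Q ≤ φ Q) ∧ u P = φ P

/-- `φ ≤ u` in a neighbourhood of `P` in `J_T`, with equality at `P`. -/
def TouchesFromBelow (e : Fin N → Plane) (T : ℝ) (φ u : ℝ × Plane → ℝ) (P : ℝ × Plane) : Prop :=
  (∀ᶠ Q in 𝓝[openCyl e T] P, φ Q ≤ u Q) ∧ u P = φ P

/-- Sub-solutions on `J_T` of `u_t + H(x, u_x) = 0`. -/
structure IsSubsolution (e : Fin N → Plane) (L : Fin N → ℝ → ℝ) (T : ℝ)
    (u : ℝ × Plane → ℝ) : Prop where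
  usc : UpperSemicontinuousOn u (cyl e T)
  onBranch : ∀ φ, IsTest e T φ → ∀ t ∈ Ioo 0 T, ∀ i, ∀ r : ℝ, 0 < r →
    TouchesFromAbove e T φ u (t, r • e i) →
    timeDeriv φ t (r • e i) + ham (L i) (branchDeriv e φ i t r) ≤ 0
  atJunction : ∀ φ, IsTest e T φ → ∀ t ∈ Ioo 0 T, TouchesFromAbove e T φ u (t, 0) →
    timeDeriv φ t 0 + (⨆ i, hamNeg (L i) (branchDeriv e φ i t 0)) ≤ 0

/-- Super-solutions on `J_T` of `u_t + H(x, u_x) = 0`. -/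
structure IsSupersolution (e : Fin N → Plane) (L : Fin N → ℝ → ℝ) (T : ℝ)
    (u : ℝ × Plane → ℝ) : Prop where
  lsc : LowerSemicontinuousOn u (cyl e T)
  onBranch : ∀ φ, IsTest e T φ → ∀ t ∈ Ioo 0 T, ∀ i, ∀ r : ℝ, 0 < r →
    TouchesFromBelow e T φ u (t, r • e i) →
    0 ≤ timeDeriv φ t (r • e i) + ham (L i) (branchDeriv e φ i t r)
  atJunction : ∀ φ, IsTest e T φ → ∀ t ∈ Ioo 0 T, TouchesFromBelow e T φ u (t, 0) →
    0 ≤ timeDeriv φ t 0 + (⨆ i, hamNeg (L i) (branchDeriv e φ i t 0))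

/-- The real-valued function `U` is the upper semi-continuous envelope `u^*` of `u` on
`[0, T) × J`. The upper limit is taken in the extended reals, so `u^*` has to be finite. -/
def IsUpperEnvelope (e : Fin N → Plane) (T : ℝ) (u U : ℝ × Plane → ℝ) : Prop :=
  ∀ P ∈ cyl e T, (U P : EReal) = limsup (fun Q => (u Q : EReal)) (𝓝[cyl e T] P)

/-- The real-valued function `V` is the lower semi-continuous envelope `u_*` of `u` on
`[0, T) × J`. -/
def IsLowerEnvelope (e : Fin N → Plane) (T : ℝ) (u V : ℝ × Plane → ℝ) : Prop :=
  ∀ P ∈ cyl e T, (V P : EReal) = liminf (fun Q => (u Q : EReal)) (𝓝[cyl e T] P)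

/-- Viscosity solutions on `J_T` of `u_t + H(x, u_x) = 0` with initial condition `u(0, ·) = u₀`:
`u^*` is a sub-solution with `u^*(0, ·) ≤ u₀`, and `u_*` is a super-solution with
`u_*(0, ·) ≥ u₀`. Only the values of `u` on `[0, T) × J` matter. -/
structure IsViscositySolution (e : Fin N → Plane) (L : Fin N → ℝ → ℝ) (T : ℝ)
    (u₀ : Plane → ℝ) (u : ℝ × Plane → ℝ) : Prop where
  upper : ∃ U, IsUpperEnvelope e T u U ∧ IsSubsolution e L T U ∧
    ∀ x ∈ junction e, U (0, x) ≤ u₀ x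
  lower : ∃ V, IsLowerEnvelope e T u V ∧ IsSupersolution e L T V ∧
    ∀ x ∈ junction e, u₀ x ≤ V (0, x)

/-- `|u(t, x) - u₀(x)| ≤ C` on `J_T` for some constant `C > 0`. -/
def AtBoundedDistance (e : Fin N → Plane) (T : ℝ) (u₀ : Plane → ℝ) (u : ℝ × Plane → ℝ) : Prop :=
  ∃ C : ℝ, 0 < C ∧ ∀ t ∈ Ioo 0 T, ∀ x ∈ junction e, |u (t, x) - u₀ x| ≤ C

end

end Junction

/-! The solution is the value function of an optimal control problem: the infimum, over polygonal
trajectories ending at `x` at time `t`, of the initial cost plus the integral of `L_i` of the speed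
(`Reach`, `value`). Both existence and uniqueness go through it, with no doubling of variables.

Existence. Superlinearity of `L_i` and the Lipschitz bound on `u₀` make `value` Lipschitz
(`abs_value_sub_le_geodDist`). Dynamic programming along one short segment gives the sub-solution
inequalities (`isSubsolution_of_segment`). If a super-solution inequality failed, a function
strictly below `value` around the point would grow at most by the cost of every short segment; since
each trajectory enters a small backward neighbourhood through its boundary, the margin there would
persist at the point itself (`add_le_value_of_boundary`).

Uniqueness. A sub-solution grows along a segment by at most its cost (`IsSubsolution.segment`),
because a steep parabola around the segment is a strict classical super-solution; summing over a
trajectory gives `u ≤ value`. For a super-solution, the value at a later time `t₁` minus the cost of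
going there from `(τ, ρ)` is a classical sub-solution, hence a barrier from below
(`IsSupersolution.le_of_barrier`). At the junction point that cost is `junctionCost`: run to the
origin at an optimal speed, then wait on the cheapest branch. Once `v ≥ value` is known at the
origin, `L_i` itself serves on each branch, and `t₁` is sent to the current time. The envelopes of
any solution are thus squeezed onto `value`. -/

namespace Junction

variable {N : ℕ}

/-! ### Strongly convex Lagrangians and their Legendre transforms -/

/-- A Lagrangian is a `C¹` strongly convex function. -/
structure IsLagrangian (L : ℝ → ℝ) : Prop where
  contDiff : ContDiff ℝ 1 L
  exists_quadratic_le :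
    ∃ γ > 0, ∀ q q', L q + deriv L q * (q' - q) + γ * (q' - q) ^ 2 ≤ L q'

/-- Subtracting `γ / 2 * (x - q) ^ 2` leaves a convex function, which lies above its tangent at `q`.
-/
theorem isLagrangian_of_le_deriv_deriv {L : ℝ → ℝ} (hL : ContDiff ℝ 2 L) {γ : ℝ} (hγ : 0 < γ)
    (h : ∀ q, γ ≤ deriv (deriv L) q) : IsLagrangian L := by
  refine ⟨hL.of_le (by norm_num), γ / 2, by positivity, fun q q' => ?_⟩
  have hd : Differentiable ℝ L := hL.differentiable (by norm_num)
  have hd1 : ContDiff ℝ 1 (deriv L) := ((contDiff_succ_iff_deriv (n := 1)).1 hL).2.2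
  have hd2 : Differentiable ℝ (deriv L) := hd1.differentiable (by norm_num)
  set f : ℝ → ℝ := fun x => L x - γ / 2 * (x - q) ^ 2 with hf
  have hfd : ∀ x, HasDerivAt f (deriv L x - γ * (x - q)) x := by
    intro x
    have h1 := (hd x).hasDerivAt.sub ((((hasDerivAt_id x).sub_const q).pow 2).const_mul (γ / 2))
    exact h1.congr_deriv (by simp only [id]; push_cast; ring)
  have hfd' : deriv f = fun x => deriv L x - γ * (x - q) := funext fun x => (hfd x).deriv
  have hfd2 : ∀ x, HasDerivAt (deriv f) (deriv (deriv L) x - γ) x := by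
    intro x
    rw [hfd']
    have h1 := (hd2 x).hasDerivAt.sub (((hasDerivAt_id x).sub_const q).const_mul γ)
    rw [mul_one] at h1
    exact h1
  have hconv : ConvexOn ℝ univ f := by
    refine convexOn_of_deriv2_nonneg convex_univ
      (fun x _ => (hfd x).continuousAt.continuousWithinAt)
      (fun x _ => (hfd x).differentiableAt.differentiableWithinAt)
      (fun x _ => (hfd2 x).differentiableAt.differentiableWithinAt) fun x _ => ?_
    have : deriv^[2] f x = deriv (deriv f) x := rfl
    rw [this, (hfd2 x).deriv]
    linarith [h x]
  have hq := hfd q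
  simp only [sub_self, mul_zero, sub_zero] at hq
  have key : f q + deriv L q * (q' - q) ≤ f q' := by
    rcases lt_trichotomy q q' with h1 | h1 | h1
    · have := hconv.le_slope_of_hasDerivAt (mem_univ _) (mem_univ _) h1 hq
      rw [slope_def_field, le_div_iff₀ (by linarith)] at this
      linarith
    · simp [h1]
    · have := hconv.slope_le_of_hasDerivAt (mem_univ _) (mem_univ _) h1 hq
      rw [slope_def_field, div_le_iff₀ (by linarith)] at this
      linarith
  simp only [hf, sub_self] at key
  linarith

namespace IsLagrangian

variable {L : ℝ → ℝ} (hL : IsLagrangian L)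

include hL

theorem hasDerivAt (q : ℝ) : HasDerivAt L (deriv L q) q :=
  (hL.contDiff.differentiable (by norm_num) q).hasDerivAt

theorem continuous_deriv : Continuous (deriv L) := hL.contDiff.continuous_deriv (by norm_num)

theorem tangent_le (q q' : ℝ) : L q + deriv L q * (q' - q) ≤ L q' := by
  obtain ⟨γ, hγ, h⟩ := hL.exists_quadratic_le
  nlinarith [h q q', mul_nonneg hγ.le (sq_nonneg (q' - q))]

theorem superlinear (k : ℝ) : ∃ C, 0 ≤ C ∧ ∀ q, k * |q| ≤ L q + C := by
  obtain ⟨γ, hγ, h⟩ := hL.exists_quadratic_le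
  set m := |k| + |deriv L 0|
  refine ⟨m ^ 2 / γ + |L 0|, by positivity, fun q => ?_⟩
  have h1 := h 0 q
  simp only [sub_zero] at h1
  have h2 : m * |q| ≤ m ^ 2 / γ + γ * q ^ 2 := by
    rw [← sq_abs q, div_add' _ _ _ hγ.ne', le_div_iff₀ hγ]
    nlinarith [sq_nonneg (m - γ * |q|), sq_nonneg m, sq_nonneg (γ * |q|)]
  have h3 : k * |q| ≤ |k| * |q| := mul_le_mul_of_nonneg_right (le_abs_self k) (abs_nonneg q)
  have h4 : -(|deriv L 0| * |q|) ≤ deriv L 0 * q := by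
    rw [← abs_mul]; exact neg_abs_le _
  have h5 := neg_abs_le (L 0)
  simp only [m, add_mul] at h2 ⊢
  linarith

theorem bddAbove (p : ℝ) : BddAbove (range fun q : ℝ => p * q - L q) := by
  obtain ⟨C, -, h⟩ := hL.superlinear |p|
  refine ⟨C, ?_⟩
  rintro _ ⟨q, rfl⟩
  have := le_abs_self (p * q)
  rw [abs_mul] at this
  simp only
  linarith [h q]

theorem le_ham (p q : ℝ) : p * q - L q ≤ ham L p := le_ciSup (hL.bddAbove p) q

omit hL in
theorem ham_le {p c : ℝ} (h : ∀ q, p * q - L q ≤ c) : ham L p ≤ c := ciSup_le h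

theorem le_hamNeg (p : ℝ) {q : ℝ} (hq : q ≤ 0) : p * q - L q ≤ hamNeg L p := by
  have hb : BddAbove (range fun q : Iic (0 : ℝ) => p * (q : ℝ) - L q) := by
    obtain ⟨C, hC⟩ := hL.bddAbove p
    refine ⟨C, ?_⟩
    rintro _ ⟨q, rfl⟩
    exact hC ⟨q, rfl⟩
  exact le_ciSup hb ⟨q, hq⟩

omit hL in
theorem hamNeg_le {p c : ℝ} (h : ∀ q ≤ 0, p * q - L q ≤ c) : hamNeg L p ≤ c :=
  ciSup_le fun q => h q q.2

theorem hamNeg_le_ham (p : ℝ) : hamNeg L p ≤ ham L p := hamNeg_le fun q _ => hL.le_ham p q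

theorem ham_deriv_le (q : ℝ) : ham L (deriv L q) ≤ deriv L q * q - L q :=
  ham_le fun q' => by linarith [hL.tangent_le q q']

theorem continuous_ham : Continuous (ham L) := by
  have : ConvexOn ℝ univ (ham L) := by
    refine ⟨convex_univ, fun x _ y _ a b ha hb hab => ham_le fun q => ?_⟩
    have h1 := mul_le_mul_of_nonneg_left (hL.le_ham x q) ha
    have h2 := mul_le_mul_of_nonneg_left (hL.le_ham y q) hb
    simp only [smul_eq_mul]
    have : L q = a * L q + b * L q := by rw [← add_mul, hab, one_mul]
    rw [this]
    linarith
  exact continuousOn_univ.1 (this.continuousOn isOpen_univ)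

/-- `H⁻(p)` is a value of `H` at some slope below `p`. -/
theorem exists_le_ham_le_hamNeg (p : ℝ) : ∃ p' ≤ p, ham L p' ≤ hamNeg L p := by
  rcases le_total p (deriv L 0) with h | h
  -- Here `q ↦ p * q - L q` is bounded on `q ≥ 0` by its value at `0`, so positive speeds do not
  -- raise the supremum. In the other case `L'(0)` is the minimum point of `H`.
  · refine ⟨p, le_rfl, ham_le fun q => ?_⟩
    rcases le_total q 0 with hq | hq
    · exact hL.le_hamNeg p hq
    · have h1 := hL.le_hamNeg p le_rfl
      nlinarith [hL.tangent_le 0 q]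
  · refine ⟨deriv L 0, h, ?_⟩
    have h1 := hL.ham_deriv_le 0
    have h2 := hL.le_hamNeg p le_rfl
    simp at h1 h2
    linarith

/-- The optimal speed for reaching a point where waiting costs `A` per unit of time. -/
theorem exists_nonpos_eq {A : ℝ} (hA : A ≤ L 0) : ∃ w ≤ 0, L w - w * deriv L w = A := by
  obtain ⟨γ, hγ, h⟩ := hL.exists_quadratic_le
  -- `L w - w * deriv L w` is the intercept at `0` of the tangent at `w`. It equals `L 0` at `w =
  -- 0`, and strong convexity puts it below `A` at `-M`.
  set M := (L 0 - A) / γ + 1 with hM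
  have hM1 : 1 ≤ M := by
    have : 0 ≤ (L 0 - A) / γ := div_nonneg (by linarith) hγ.le
    linarith
  have hc : ContinuousOn (fun w => L w - w * deriv L w) (Icc (-M) 0) :=
    (hL.contDiff.continuous.sub (continuous_id.mul hL.continuous_deriv)).continuousOn
  have h1 := h (-M) 0
  have h2 : γ * M = L 0 - A + γ := by rw [hM]; field_simp
  have h3 : γ * M ≤ γ * M ^ 2 := by nlinarith
  have := intermediate_value_Icc (by linarith : -M ≤ 0) hc
  obtain ⟨w, hw, hw'⟩ := @this A ⟨by nlinarith, by simpa using hA⟩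
  exact ⟨w, hw.2, hw'⟩

end IsLagrangian

/-! ### Branch coordinates on the junction -/

section Geometry

variable {e : Fin N → Plane}

theorem smul_mem_branch (i : Fin N) {r : ℝ} (hr : 0 ≤ r) : r • e i ∈ branch e i := ⟨r, hr, rfl⟩

theorem smul_mem_junction (i : Fin N) {r : ℝ} (hr : 0 ≤ r) : r • e i ∈ junction e :=
  mem_iUnion.2 ⟨i, smul_mem_branch i hr⟩

theorem exists_eq_smul {x : Plane} (hx : x ∈ junction e) : ∃ i, ∃ r : ℝ, 0 ≤ r ∧ x = r • e i :=
  mem_iUnion.1 hx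

variable (he : ∀ i, ‖e i‖ = 1)

include he

theorem norm_smul_unit (i : Fin N) {r : ℝ} (hr : 0 ≤ r) : ‖r • e i‖ = r := by
  rw [norm_smul, he, mul_one, Real.norm_of_nonneg hr]

theorem mem_branch_iff {i : Fin N} {x : Plane} : x ∈ branch e i ↔ x = ‖x‖ • e i := by
  refine ⟨?_, fun h => ⟨_, norm_nonneg _, h⟩⟩
  rintro ⟨r, hr, rfl⟩
  rw [norm_smul_unit he i hr]

theorem eq_of_smul_mem_branch (he_inj : Function.Injective e) {i j : Fin N} {r : ℝ} (hr : 0 < r)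
    (h : r • e i ∈ branch e j) : i = j := by
  rw [mem_branch_iff he, norm_smul_unit he i hr.le] at h
  exact he_inj (smul_right_injective _ hr.ne' h)

theorem isClosed_branch (i : Fin N) : IsClosed (branch e i) := by
  have : branch e i = {x | x = ‖x‖ • e i} := by
    ext x; exact mem_branch_iff he
  rw [this]
  exact isClosed_eq continuous_id (continuous_norm.smul continuous_const)

/-- The junction is a finite union of closed branches, so only the branches through `x` matter near
`x`. -/
theorem eventually_nhdsWithin_prod_junction {S : Set ℝ} {t : ℝ} {x : Plane}
    {p : ℝ × Plane → Prop}
    (h : ∀ j, x ∈ branch e j → ∀ᶠ z in 𝓝[S ×ˢ Ici 0] (t, ‖x‖), p (z.1, z.2 • e j)) :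
    ∀ᶠ Q in 𝓝[S ×ˢ junction e] (t, x), p Q := by
  rw [junction, prod_iUnion, nhdsWithin_iUnion, eventually_iSup]
  intro j
  by_cases hx : x ∈ branch e j
  · have hc : Tendsto (fun Q : ℝ × Plane => (Q.1, ‖Q.2‖)) (𝓝[S ×ˢ branch e j] (t, x))
        (𝓝[S ×ˢ Ici 0] (t, ‖x‖)) := by
      refine tendsto_nhdsWithin_iff.2 ⟨?_, ?_⟩
      · exact ((continuous_fst.prodMk continuous_snd.norm).tendsto (t, x)).mono_left
          nhdsWithin_le_nhds
      · exact eventually_nhdsWithin_of_forall fun Q hQ => ⟨hQ.1, norm_nonneg Q.2⟩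
    filter_upwards [hc.eventually (h j hx), self_mem_nhdsWithin] with Q hQ hQ'
    simp only [← (mem_branch_iff he).1 hQ'.2] at hQ
    exact hQ
  · have : ((univ : Set ℝ) ×ˢ branch e j)ᶜ ∈ 𝓝 (t, x) :=
      (isClosed_univ.prod (isClosed_branch he j)).isOpen_compl.mem_nhds (by simpa using hx)
    filter_upwards [nhdsWithin_le_nhds this, self_mem_nhdsWithin] with Q hQ hQ'
    exact absurd ⟨mem_univ _, hQ'.2⟩ hQ

theorem continuousOn_prod_junction {S : Set ℝ} {g : ℝ × Plane → ℝ}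
    (h : ∀ i, ContinuousOn (fun z : ℝ × ℝ => g (z.1, z.2 • e i)) (S ×ˢ Ici 0)) :
    ContinuousOn g (S ×ˢ junction e) := by
  rintro ⟨t, x⟩ ⟨ht, -⟩
  refine tendsto_nhds.2 fun V hV hx => ?_
  refine eventually_nhdsWithin_prod_junction he fun j hj => ?_
  have := (h j (t, ‖x‖) ⟨ht, norm_nonneg x⟩)
  refine this.eventually (hV.mem_nhds ?_)
  simpa only [← (mem_branch_iff he).1 hj] using hx

end Geometry

/-! ### Test functions assembled from functions on the branches -/

section TestFunctions

variable {e : Fin N → Plane}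

open Classical in
/-- The function on `ℝ × J` with prescribed restrictions to the branches. -/
noncomputable def glue (e : Fin N → Plane) (f : Fin N → ℝ × ℝ → ℝ) (P : ℝ × Plane) : ℝ :=
  if h : ∃ j, P.2 ∈ branch e j then f h.choose (P.1, ‖P.2‖) else 0

variable (he : ∀ i, ‖e i‖ = 1) (he_inj : Function.Injective e)

include he he_inj

theorem glue_apply {f : Fin N → ℝ × ℝ → ℝ} (hf : ∀ i j s, f i (s, 0) = f j (s, 0))
    (i : Fin N) (s : ℝ) {r : ℝ} (hr : 0 ≤ r) : glue e f (s, r • e i) = f i (s, r) := by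
  have h : ∃ j, (s, r • e i).2 ∈ branch e j := ⟨i, smul_mem_branch i hr⟩
  rw [glue, dif_pos h]
  simp only [norm_smul_unit he i hr]
  rcases hr.eq_or_lt with rfl | hr
  · exact hf _ _ _
  · rw [← eq_of_smul_mem_branch he he_inj hr h.choose_spec]

theorem isTest_glue {f : Fin N → ℝ × ℝ → ℝ} (hf : ∀ i j s, f i (s, 0) = f j (s, 0)) {T : ℝ}
    (hc : ∀ i, ContDiff ℝ 1 (f i)) : IsTest e T (glue e f) := by
  have h : ∀ i, EqOn (fun z : ℝ × ℝ => glue e f (z.1, z.2 • e i)) (f i) (Ioo 0 T ×ˢ Ici 0) :=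
    fun i z hz => glue_apply he he_inj hf i z.1 hz.2
  exact ⟨continuousOn_prod_junction he fun i => (hc i).continuous.continuousOn.congr (h i),
    fun i => (hc i).contDiffOn.congr (h i)⟩

/-- A family of functions on the branches that is `C¹` before a time `t₁` and matches at the
junction point coincides with a test function near any earlier time. -/
theorem exists_isTest {f : Fin N → ℝ × ℝ → ℝ} (hf : ∀ i j s, f i (s, 0) = f j (s, 0)) (T : ℝ)
    {t t₁ : ℝ} (ht : t < t₁) (hc : ∀ i, ContDiffOn ℝ 1 (f i) (Iio t₁ ×ˢ univ)) :
    ∃ φ, IsTest e T φ ∧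
      ∀ᶠ s in 𝓝 t, ∀ i, ∀ r : ℝ, 0 ≤ r → φ (s, r • e i) = f i (s, r) := by
  -- Test functions must be smooth on all of `(0, T)`, while `f` is so only before `t₁`. Time is
  -- therefore replaced by `σ`, which is the identity near `t` and stays below `t₁`.
  let χ : ContDiffBump t := ⟨(t₁ - t) / 4, (t₁ - t) / 2, by linarith, by linarith⟩
  let σ : ℝ → ℝ := fun s => t + χ s * (s - t)
  have hσc : ContDiff ℝ 1 σ := by
    have := χ.contDiff (n := 1)
    fun_prop
  have hσ : ∀ s, σ s < t₁ := by
    intro s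
    have h0 := χ.nonneg (x := s)
    have h1 := χ.le_one (x := s)
    rcases lt_or_ge (dist s t) ((t₁ - t) / 2) with h | h
    · rw [Real.dist_eq] at h
      have h2 := le_abs_self (s - t)
      have h3 := abs_nonneg (s - t)
      simp only [σ]
      nlinarith
    · simp only [σ, χ.zero_of_le_dist h]
      linarith
  have hσt : ∀ᶠ s in 𝓝 t, σ s = s := by
    filter_upwards [χ.eventuallyEq_one] with s hs
    simp only [σ, hs, Pi.one_apply]
    ring
  refine ⟨glue e fun i z => f i (σ z.1, z.2),
    isTest_glue (f := fun i z => f i (σ z.1, z.2)) he he_inj (fun i j s => hf i j _)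
      fun i => ?_, ?_⟩
  · have h1 : ContDiff ℝ 1 fun z : ℝ × ℝ => (σ z.1, z.2) :=
      (hσc.comp contDiff_fst).prodMk contDiff_snd
    exact contDiffOn_univ.1 ((hc i).comp h1.contDiffOn fun z _ => ⟨hσ _, mem_univ _⟩)
  · filter_upwards [hσt] with s hs i r hr
    rw [glue_apply (f := fun i z => f i (σ z.1, z.2)) he he_inj (fun i j s => hf i j _) i s hr, hs]

end TestFunctions

/-! ### Viscosity inequalities in branch coordinates -/

section Local

variable {e : Fin N → Plane} {T : ℝ} {φ : ℝ × Plane → ℝ}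

theorem timeDeriv_eq {t r a : ℝ} {i : Fin N} {f : ℝ × ℝ → ℝ}
    (h : ∀ᶠ s in 𝓝 t, φ (s, r • e i) = f (s, r)) (hf : HasDerivAt (fun s => f (s, r)) a t) :
    timeDeriv φ t (r • e i) = a :=
  (EventuallyEq.deriv_eq h).trans hf.deriv

theorem branchDeriv_eq {t r p : ℝ} (hr : 0 ≤ r) {i : Fin N} {f : ℝ × ℝ → ℝ}
    (h : ∀ r : ℝ, 0 ≤ r → φ (t, r • e i) = f (t, r)) (hf : HasDerivAt (fun ρ => f (t, ρ)) p r) :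
    branchDeriv e φ i t r = p := by
  have h1 : EqOn (fun ρ : ℝ => φ (t, ρ • e i)) (fun ρ => f (t, ρ)) (Ici 0) := fun ρ hρ => h ρ hρ
  rw [branchDeriv, derivWithin_congr h1 (h r hr)]
  exact hf.hasDerivWithinAt.derivWithin (uniqueDiffOn_Ici 0 r hr)

end Local

section Inequalities

variable {e : Fin N → Plane} (he : ∀ i, ‖e i‖ = 1) (he_inj : Function.Injective e)
  {L : Fin N → ℝ → ℝ} {T : ℝ} {u : ℝ × Plane → ℝ}

include he he_inj

/-- Touching at an interior point of a branch, by a function of the branch coordinates. -/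
theorem exists_isTest_branch {f : ℝ × ℝ → ℝ} {t₁ t r a p : ℝ} {i : Fin N} (ht1 : t < t₁)
    (hr : 0 < r) (hc : ContDiffOn ℝ 1 f (Iio t₁ ×ˢ univ))
    (ha : HasDerivAt (fun s => f (s, r)) a t) (hp : HasDerivAt (fun ρ => f (t, ρ)) p r) :
    ∃ φ, IsTest e T φ ∧ timeDeriv φ t (r • e i) = a ∧ branchDeriv e φ i t r = p ∧
      φ (t, r • e i) = f (t, r) ∧ ∀ q : ℝ → ℝ × Plane → Prop,
        (∀ᶠ z in 𝓝 (t, r), q (f z) (z.1, z.2 • e i)) →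
          ∀ᶠ Q in 𝓝[openCyl e T] (t, r • e i), q (φ Q) Q := by
  classical
  -- On the other branches `f` is extended by its trace at the junction point, constant in space.
  let F : Fin N → ℝ × ℝ → ℝ := fun j z => if j = i then f z else f (z.1, 0)
  have hF : ∀ j k s, F j (s, 0) = F k (s, 0) := by
    intro j k s
    simp [F]
  have hFc : ∀ j, ContDiffOn ℝ 1 (F j) (Iio t₁ ×ˢ univ) := by
    intro j
    by_cases h : j = i
    · simpa [F, h] using hc
    · have h1 : ContDiff ℝ 1 fun z : ℝ × ℝ => (z.1, (0 : ℝ)) := contDiff_fst.prodMk contDiff_const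
      simpa [F, h, Function.comp_def] using
        hc.comp h1.contDiffOn fun z hz => ⟨hz.1, mem_univ _⟩
  have hFi : F i = f := by ext z; simp [F]
  obtain ⟨φ, hφ, hφe⟩ := exists_isTest he he_inj hF T ht1 hFc
  have hφi : ∀ᶠ s in 𝓝 t, ∀ r : ℝ, 0 ≤ r → φ (s, r • e i) = f (s, r) := by
    filter_upwards [hφe] with s hs
    simpa [hFi] using hs i
  refine ⟨φ, hφ, timeDeriv_eq (hφi.mono fun s hs => hs r hr.le) ha,
    branchDeriv_eq hr.le hφi.self_of_nhds hp, hφi.self_of_nhds r hr.le, fun q hq => ?_⟩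
  refine eventually_nhdsWithin_prod_junction he fun j hj => ?_
  obtain rfl := eq_of_smul_mem_branch he he_inj hr hj
  rw [norm_smul_unit he i hr.le]
  have h1 : ∀ᶠ z : ℝ × ℝ in 𝓝 (t, r), ∀ r : ℝ, 0 ≤ r → φ (z.1, r • e i) = f (z.1, r) :=
    (continuous_fst.tendsto (t, r)).eventually hφi
  filter_upwards [nhdsWithin_le_nhds hq, nhdsWithin_le_nhds h1, self_mem_nhdsWithin]
    with z hz hz1 hz2
  rw [hz1 _ hz2.2]
  exact hz

/-- Touching at the junction point, by functions of the branch coordinates. -/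
theorem exists_isTest_junction (hN : 1 ≤ N) {f : Fin N → ℝ × ℝ → ℝ} {t₁ t a : ℝ} {p : Fin N → ℝ}
    (hf : ∀ i j s, f i (s, 0) = f j (s, 0)) (ht1 : t < t₁)
    (hc : ∀ i, ContDiffOn ℝ 1 (f i) (Iio t₁ ×ˢ univ))
    (ha : ∀ i, HasDerivAt (fun s => f i (s, 0)) a t)
    (hp : ∀ i, HasDerivAt (fun ρ => f i (t, ρ)) (p i) 0) :
    ∃ φ, IsTest e T φ ∧ timeDeriv φ t 0 = a ∧ (∀ i, branchDeriv e φ i t 0 = p i) ∧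
      (∀ i, φ (t, 0) = f i (t, 0)) ∧ ∀ q : ℝ → ℝ × Plane → Prop,
        (∀ i, ∀ᶠ z in 𝓝 (t, (0 : ℝ)), 0 ≤ z.2 → q (f i z) (z.1, z.2 • e i)) →
          ∀ᶠ Q in 𝓝[openCyl e T] (t, 0), q (φ Q) Q := by
  obtain ⟨φ, hφ, hφe⟩ := exists_isTest he he_inj hf T ht1 hc
  refine ⟨φ, hφ, ?_, fun i => branchDeriv_eq le_rfl (hφe.self_of_nhds i) (hp i), fun i => ?_,
    fun q hq => ?_⟩
  · have := timeDeriv_eq (e := e) (i := ⟨0, hN⟩) (hφe.mono fun s hs => hs ⟨0, hN⟩ 0 le_rfl) (ha _)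
    simpa using this
  · simpa using hφe.self_of_nhds i 0 le_rfl
  · refine eventually_nhdsWithin_prod_junction he fun j _ => ?_
    rw [norm_zero]
    have h1 : ∀ᶠ z : ℝ × ℝ in 𝓝 (t, 0), ∀ j, ∀ r : ℝ, 0 ≤ r → φ (z.1, r • e j) = f j (z.1, r) :=
      (continuous_fst.tendsto (t, (0 : ℝ))).eventually hφe
    filter_upwards [nhdsWithin_le_nhds (hq j), nhdsWithin_le_nhds h1, self_mem_nhdsWithin]
      with z hz hz1 hz2
    rw [hz1 _ _ hz2.2]
    exact hz hz2.2

theorem IsSubsolution.branch_ineq (hu : IsSubsolution e L T u) {f : ℝ × ℝ → ℝ} {t₁ t r a p : ℝ}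
    {i : Fin N} (ht : t ∈ Ioo 0 T) (ht1 : t < t₁) (hr : 0 < r)
    (hc : ContDiffOn ℝ 1 f (Iio t₁ ×ˢ univ))
    (ha : HasDerivAt (fun s => f (s, r)) a t) (hp : HasDerivAt (fun ρ => f (t, ρ)) p r)
    (hmax : ∀ᶠ z in 𝓝 (t, r), u (z.1, z.2 • e i) ≤ f z) (heq : u (t, r • e i) = f (t, r)) :
    a + ham (L i) p ≤ 0 := by
  obtain ⟨φ, hφ, rfl, rfl, hφ0, hφq⟩ :=
    exists_isTest_branch (i := i) (T := T) he he_inj ht1 hr hc ha hp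
  exact hu.onBranch φ hφ t ht i r hr ⟨hφq (fun y Q => u Q ≤ y) hmax, heq.trans hφ0.symm⟩

theorem IsSupersolution.branch_ineq (hu : IsSupersolution e L T u) {f : ℝ × ℝ → ℝ}
    {t₁ t r a p : ℝ} {i : Fin N} (ht : t ∈ Ioo 0 T) (ht1 : t < t₁) (hr : 0 < r)
    (hc : ContDiffOn ℝ 1 f (Iio t₁ ×ˢ univ))
    (ha : HasDerivAt (fun s => f (s, r)) a t) (hp : HasDerivAt (fun ρ => f (t, ρ)) p r)
    (hmin : ∀ᶠ z in 𝓝 (t, r), f z ≤ u (z.1, z.2 • e i)) (heq : u (t, r • e i) = f (t, r)) :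
    0 ≤ a + ham (L i) p := by
  obtain ⟨φ, hφ, rfl, rfl, hφ0, hφq⟩ :=
    exists_isTest_branch (i := i) (T := T) he he_inj ht1 hr hc ha hp
  exact hu.onBranch φ hφ t ht i r hr ⟨hφq (fun y Q => y ≤ u Q) hmin, heq.trans hφ0.symm⟩

theorem IsSubsolution.junction_ineq (hN : 1 ≤ N) (hu : IsSubsolution e L T u)
    {f : Fin N → ℝ × ℝ → ℝ} {t₁ t a : ℝ} {p : Fin N → ℝ} (ht : t ∈ Ioo 0 T) (ht1 : t < t₁)
    (hf : ∀ i j s, f i (s, 0) = f j (s, 0)) (hc : ∀ i, ContDiffOn ℝ 1 (f i) (Iio t₁ ×ˢ univ))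
    (ha : ∀ i, HasDerivAt (fun s => f i (s, 0)) a t)
    (hp : ∀ i, HasDerivAt (fun ρ => f i (t, ρ)) (p i) 0)
    (hmax : ∀ i, ∀ᶠ z in 𝓝 (t, (0 : ℝ)), 0 ≤ z.2 → u (z.1, z.2 • e i) ≤ f i z)
    (heq : ∀ i, u (t, 0) = f i (t, 0)) (i : Fin N) : a + hamNeg (L i) (p i) ≤ 0 := by
  obtain ⟨φ, hφ, rfl, hφp, hφ0, hφq⟩ :=
    exists_isTest_junction (T := T) he he_inj hN hf ht1 hc ha hp
  have := hu.atJunction φ hφ t ht ⟨hφq (fun y Q => u Q ≤ y) hmax, (heq i).trans (hφ0 i).symm⟩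
  simp only [hφp] at this
  have h1 : hamNeg (L i) (p i) ≤ ⨆ i, hamNeg (L i) (p i) :=
    le_ciSup (f := fun i => hamNeg (L i) (p i)) (finite_range _).bddAbove i
  linarith

theorem IsSupersolution.junction_ineq (hN : 1 ≤ N) (hu : IsSupersolution e L T u)
    {f : Fin N → ℝ × ℝ → ℝ} {t₁ t a : ℝ} {p : Fin N → ℝ} (ht : t ∈ Ioo 0 T) (ht1 : t < t₁)
    (hf : ∀ i j s, f i (s, 0) = f j (s, 0)) (hc : ∀ i, ContDiffOn ℝ 1 (f i) (Iio t₁ ×ˢ univ))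
    (ha : ∀ i, HasDerivAt (fun s => f i (s, 0)) a t)
    (hp : ∀ i, HasDerivAt (fun ρ => f i (t, ρ)) (p i) 0)
    (hmin : ∀ i, ∀ᶠ z in 𝓝 (t, (0 : ℝ)), 0 ≤ z.2 → f i z ≤ u (z.1, z.2 • e i))
    (heq : ∀ i, u (t, 0) = f i (t, 0)) : ∃ i, 0 ≤ a + hamNeg (L i) (p i) := by
  obtain ⟨φ, hφ, rfl, hφp, hφ0, hφq⟩ :=
    exists_isTest_junction (T := T) he he_inj hN hf ht1 hc ha hp
  have : Nonempty (Fin N) := ⟨⟨0, hN⟩⟩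
  have h := hu.atJunction φ hφ t ht
    ⟨hφq (fun y Q => y ≤ u Q) hmin, (heq ⟨0, hN⟩).trans (hφ0 _).symm⟩
  simp only [hφp] at h
  obtain ⟨i, hi⟩ := exists_eq_ciSup_of_finite (f := fun i => hamNeg (L i) (p i))
  exact ⟨i, by rw [hi]; exact h⟩

end Inequalities

/-! ### A one-sided `C¹` time penalty, and extrema of semicontinuous functions -/

section PosPart

theorem hasDerivAt_max_sq (x : ℝ) : HasDerivAt (fun x : ℝ => max x 0 ^ 2) (2 * max x 0) x := by
  rcases lt_trichotomy x 0 with h | rfl | h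
  · rw [max_eq_right h.le, mul_zero]
    refine (hasDerivAt_const x (0 : ℝ)).congr_of_eventuallyEq ?_
    filter_upwards [eventually_lt_nhds h] with y hy
    simp [max_eq_right hy.le]
  · rw [max_self, mul_zero, hasDerivAt_iff_tendsto_slope]
    refine squeeze_zero_norm (a := fun y : ℝ => |y|) (fun y => ?_) ?_
    · rw [slope_def_field, max_self, Real.norm_eq_abs]
      simp only [ne_eq, OfNat.ofNat_ne_zero, not_false_eq_true, zero_pow, sub_zero]
      rcases le_total y 0 with hy | hy
      · simp [max_eq_right hy]
      · rw [max_eq_left hy, sq, mul_self_div_self]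
    · have : Tendsto (fun y : ℝ => |y|) (𝓝 0) (𝓝 |0|) := continuous_abs.tendsto 0
      rw [abs_zero] at this
      exact this.mono_left nhdsWithin_le_nhds
  · rw [max_eq_left h.le]
    have h1 : HasDerivAt (fun y : ℝ => y ^ 2) (2 * x) x := by simpa using hasDerivAt_pow 2 x
    refine h1.congr_of_eventuallyEq ?_
    filter_upwards [eventually_gt_nhds h] with y hy
    simp [max_eq_left (le_of_lt hy)]

theorem contDiff_max_sq : ContDiff ℝ 1 fun x : ℝ => max x 0 ^ 2 := by
  rw [contDiff_one_iff_deriv]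
  refine ⟨fun x => (hasDerivAt_max_sq x).differentiableAt, ?_⟩
  rw [funext fun x => (hasDerivAt_max_sq x).deriv]
  fun_prop

end PosPart

section Semicontinuity

variable {e : Fin N → Plane} {T : ℝ} {u : ℝ × Plane → ℝ}

theorem continuous_branch_coord (j : Fin N) :
    Continuous fun z : ℝ × ℝ => ((z.1, z.2 • e j) : ℝ × Plane) := by fun_prop

theorem upperSemicontinuousOn_branch (hu : UpperSemicontinuousOn u (cyl e T)) (j : Fin N) :
    UpperSemicontinuousOn (fun z : ℝ × ℝ => u (z.1, z.2 • e j)) (Ico 0 T ×ˢ Ici 0) :=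
  hu.comp (continuous_branch_coord j).continuousOn fun _ hz => ⟨hz.1, smul_mem_junction j hz.2⟩

theorem lowerSemicontinuousOn_branch (hu : LowerSemicontinuousOn u (cyl e T)) (j : Fin N) :
    LowerSemicontinuousOn (fun z : ℝ × ℝ => u (z.1, z.2 • e j)) (Ico 0 T ×ˢ Ici 0) :=
  LowerSemicontinuousOn.comp hu (continuous_branch_coord j).continuousOn
    fun _ hz => ⟨hz.1, smul_mem_junction j hz.2⟩

theorem exists_forall_le_of_compact (hu : UpperSemicontinuousOn u (cyl e T)) {K : Set (ℝ × ℝ)}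
    (hK : IsCompact K) (hKs : K ⊆ Ico 0 T ×ˢ Ici 0) :
    ∃ B, ∀ j : Fin N, ∀ z ∈ K, u (z.1, z.2 • e j) ≤ B := by
  rcases K.eq_empty_or_nonempty with rfl | hne
  · exact ⟨0, by simp⟩
  have h : ∀ j : Fin N, ∃ B, ∀ z ∈ K, u (z.1, z.2 • e j) ≤ B := fun j => by
    obtain ⟨z, -, hz⟩ := ((upperSemicontinuousOn_branch hu j).mono hKs).exists_isMaxOn hne hK
    exact ⟨_, fun w hw => hz hw⟩
  choose B hB using h
  obtain ⟨C, hC⟩ := (finite_range B).bddAbove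
  exact ⟨C, fun j z hz => (hB j z hz).trans (hC ⟨j, rfl⟩)⟩

/-- A maximum point over finitely many compact pieces of branches. -/
theorem exists_max_of_compact (hN : 1 ≤ N) (hu : UpperSemicontinuousOn u (cyl e T))
    {K : Set (ℝ × ℝ)} (hne : K.Nonempty) (hK : IsCompact K) (hKs : K ⊆ Ico 0 T ×ˢ Ici 0)
    {f : Fin N → ℝ × ℝ → ℝ} (hf : ∀ j, ContinuousOn (f j) K) :
    ∃ j, ∃ z ∈ K, ∀ i, ∀ w ∈ K, u (w.1, w.2 • e i) - f i w ≤ u (z.1, z.2 • e j) - f j z := by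
  have h : ∀ j : Fin N, ∃ z ∈ K, ∀ w ∈ K,
      u (w.1, w.2 • e j) - f j w ≤ u (z.1, z.2 • e j) - f j z := fun j => by
    have h1 := ((upperSemicontinuousOn_branch hu j).mono hKs).add
      (hf j).neg.upperSemicontinuousOn
    obtain ⟨z, hzK, hz⟩ := h1.exists_isMaxOn hne hK
    exact ⟨z, hzK, fun w hw => by simpa [sub_eq_add_neg] using hz hw⟩
  choose z hzK hz using h
  have : Nonempty (Fin N) := ⟨⟨0, hN⟩⟩
  obtain ⟨j, hj⟩ := Finite.exists_max fun j => u ((z j).1, (z j).2 • e j) - f j (z j)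
  exact ⟨j, z j, hzK j, fun i w hw => (hz i w hw).trans (hj i)⟩

end Semicontinuity

/-! ### Sub-solutions grow along segments by at most their cost -/

section Subsolution

variable {e : Fin N → Plane} (he : ∀ i, ‖e i‖ = 1) (he_inj : Function.Injective e)
  {L : Fin N → ℝ → ℝ} (hL : ∀ i, IsLagrangian (L i)) {T : ℝ} {u : ℝ × Plane → ℝ}

include he in
theorem exists_lt_near (hu : UpperSemicontinuousOn u (cyl e T)) {i : Fin N} {s r c : ℝ}
    (hs : s ∈ Ico 0 T) (hr : 0 ≤ r) (hc : u (s, r • e i) < c) :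
    ∃ δ > 0, (∀ ρ : ℝ, 0 ≤ ρ → |ρ - r| < δ → u (s, ρ • e i) < c) ∧
      ∀ j, ∀ ρ : ℝ, 0 ≤ ρ → ρ + r < δ → u (s, ρ • e j) < c := by
  obtain ⟨δ, hδ, h⟩ := Metric.mem_nhdsWithin_iff.1
    (hu (s, r • e i) ⟨hs, smul_mem_junction i hr⟩ c hc)
  have key : ∀ j, ∀ ρ : ℝ, 0 ≤ ρ → ‖ρ • e j - r • e i‖ < δ → u (s, ρ • e j) < c := by
    intro j ρ hρ hlt
    refine h ⟨?_, hs, smul_mem_junction j hρ⟩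
    rw [Metric.mem_ball, Prod.dist_eq, dist_self, dist_eq_norm, max_lt_iff]
    exact ⟨hδ, hlt⟩
  refine ⟨δ, hδ, fun ρ hρ h => key i ρ hρ ?_, fun j ρ hρ h => key j ρ hρ ?_⟩
  · rwa [← sub_smul, norm_smul, he, mul_one]
  · refine (norm_sub_le _ _).trans_lt ?_
    rwa [norm_smul_unit he j hρ, norm_smul_unit he i hr]

/-- The barrier that separates a sub-solution from a segment on the branch `J_i`. -/
theorem exists_segment_barrier (i : Fin N) (c m M k s t r q : ℝ) {l : ℝ → ℝ}
    (hl : ∀ τ, l τ = r + q * (τ - s)) :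
    ∃ f : Fin N → ℝ × ℝ → ℝ,
      (∀ z, f i z = c + m * (z.1 - s) + M * max (z.1 - t) 0 ^ 2 +
        M * (z.2 - l z.1) ^ 2) ∧
      (∀ j, j ≠ i → ∀ z, f j z = c + m * (z.1 - s) + M * max (z.1 - t) 0 ^ 2 +
        (M * l z.1 ^ 2 + k * z.2)) ∧
      (∀ j, ContDiff ℝ 1 (f j)) ∧
      (∀ τ ρ, HasDerivAt (fun τ => f i (τ, ρ))
        (m + 2 * M * max (τ - t) 0 + 2 * M * (ρ - l τ) * (-q)) τ) ∧
      (∀ τ ρ, HasDerivAt (fun ρ => f i (τ, ρ)) (2 * M * (ρ - l τ)) ρ) ∧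
      (∀ j, j ≠ i → ∀ τ ρ, HasDerivAt (fun τ => f j (τ, ρ))
        (m + 2 * M * max (τ - t) 0 + 2 * M * (0 - l τ) * (-q)) τ) ∧
      (∀ j, j ≠ i → ∀ τ ρ, HasDerivAt (fun ρ => f j (τ, ρ)) k ρ) := by
  classical
  obtain rfl : l = fun τ => r + q * (τ - s) := funext hl
  simp only
  have hmaxc : ContDiff ℝ 1 fun z : ℝ × ℝ => max (z.1 - t) 0 ^ 2 :=
    contDiff_max_sq.comp (contDiff_fst.sub contDiff_const)
  have hmaxd : ∀ τ, HasDerivAt (fun τ => c + m * (τ - s) + M * max (τ - t) 0 ^ 2)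
      (m + 2 * M * max (τ - t) 0) τ := by
    intro τ
    have h1 : HasDerivAt (fun τ : ℝ => max (τ - t) 0 ^ 2) (2 * max (τ - t) 0) τ := by
      simpa [Function.comp_def] using
        (hasDerivAt_max_sq (τ - t)).comp τ ((hasDerivAt_id τ).sub_const t)
    have h2 : HasDerivAt (fun τ : ℝ => m * (τ - s)) m τ := by
      simpa using ((hasDerivAt_id τ).sub_const s).const_mul m
    exact ((h2.const_add c).add (h1.const_mul M)).congr_deriv (by ring)
  have hld : ∀ τ ρ, HasDerivAt (fun τ => M * (ρ - (r + q * (τ - s))) ^ 2)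
      (2 * M * (ρ - (r + q * (τ - s))) * (-q)) τ := by
    intro τ ρ
    have h1 : HasDerivAt (fun τ => ρ - (r + q * (τ - s))) (-q) τ := by
      simpa using ((((hasDerivAt_id τ).sub_const s).const_mul q).const_add r).const_sub ρ
    exact ((h1.pow 2).const_mul M).congr_deriv (by push_cast; ring)
  have hrd : ∀ τ ρ, HasDerivAt (fun ρ => M * (ρ - (r + q * (τ - s))) ^ 2)
      (2 * M * (ρ - (r + q * (τ - s)))) ρ := by
    intro τ ρ
    have h1 : HasDerivAt (fun ρ => ρ - (r + q * (τ - s))) 1 ρ := (hasDerivAt_id ρ).sub_const _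
    exact ((h1.pow 2).const_mul M).congr_deriv (by push_cast; ring)
  refine ⟨fun j z => c + m * (z.1 - s) + M * max (z.1 - t) 0 ^ 2 +
    if j = i then M * (z.2 - (r + q * (z.1 - s))) ^ 2
      else M * (r + q * (z.1 - s)) ^ 2 + k * z.2, fun z => by simp, fun j hj z => by simp [hj],
    fun j => ?_, fun τ ρ => ?_, fun τ ρ => ?_, fun j hj τ ρ => ?_, fun j hj τ ρ => ?_⟩
  · by_cases hj : j = i
    · simp only [hj, if_true]
      fun_prop
    · simp only [hj, if_false]
      fun_prop
  · simp only [if_true]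
    exact (hmaxd τ).add (hld τ ρ)
  · simp only [if_true]
    exact (hrd τ ρ).const_add _
  · simp only [hj, if_false]
    refine (((hmaxd τ).add (hld τ 0)).add_const (k * ρ)).congr_of_eventuallyEq
      (Eventually.of_forall fun τ => ?_)
    simp only [Pi.add_apply]
    ring
  · simp only [hj, if_false]
    refine HasDerivAt.const_add _ (HasDerivAt.const_add _ ?_)
    simpa using (hasDerivAt_id ρ).const_mul k

-- If the bound failed, `u` minus the barrier of `exists_segment_barrier` would have a positive
-- interior maximum. The barrier is a strict super-solution: on branch `i` the terms in `M * (ρ - l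
-- τ) * q` cancel between its time derivative and `H(p) ≥ p * q - L q`, leaving at least `η`. The
-- hypothesis `hq` keeps the maximum away from the junction point unless `q` is admissible in `H⁻`.
set_option maxHeartbeats 1000000 in
include he he_inj hL in
theorem IsSubsolution.segment_of_pos (hN : 1 ≤ N) (hu : IsSubsolution e L T u) {i : Fin N}
    {s t r q : ℝ} (hs : 0 < s) (hst : s < t) (htT : t < T) (hr : 0 ≤ r)
    (hr' : 0 ≤ r + q * (t - s)) (hq : q ≤ 0 ∨ 0 < r) :
    u (t, (r + q * (t - s)) • e i) ≤ u (s, r • e i) + (t - s) * L i q := by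
  by_contra! hcon
  obtain ⟨D, hD⟩ : ∃ x, x = u (t, (r + q * (t - s)) • e i) - u (s, r • e i) -
    (t - s) * L i q := ⟨_, rfl⟩
  have hDpos : 0 < D := by linarith
  obtain ⟨c, hc⟩ : ∃ x, x = u (s, r • e i) + D / 4 := ⟨_, rfl⟩
  obtain ⟨η, hη⟩ : ∃ x, x = D / (4 * (t - s)) := ⟨_, rfl⟩
  have hts : 0 < t - s := by linarith
  have hηpos : 0 < η := by rw [hη]; positivity
  have hηe : (t - s) * η = D / 4 := by rw [hη]; field_simp
  obtain ⟨t', ht'⟩ : ∃ x, x = (t + T) / 2 := ⟨_, rfl⟩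
  have htt' : t < t' := by linarith
  have ht'T : t' < T := by linarith
  obtain ⟨δ, hδ, hδ1, hδ2⟩ := exists_lt_near (c := c) he hu.usc (i := i)
    ⟨hs.le, hst.trans htT⟩ hr (by linarith)
  obtain ⟨R, hR⟩ : ∃ x, x = r + |q| * (t' - s) + 1 := ⟨_, rfl⟩
  have hqs : 0 ≤ |q| * (t' - s) := mul_nonneg (abs_nonneg _) (by linarith)
  have hR1 : 1 ≤ R := by linarith
  have hKc : IsCompact (Icc s t' ×ˢ Icc 0 R) := isCompact_Icc.prod isCompact_Icc
  have hKs : Icc s t' ×ˢ Icc 0 R ⊆ Ico 0 T ×ˢ Ici 0 := fun z hz =>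
    ⟨⟨hs.le.trans hz.1.1, hz.1.2.trans_lt ht'T⟩, hz.2.1⟩
  obtain ⟨B, hB⟩ := exists_forall_le_of_compact hu.usc hKc hKs
  obtain ⟨l, hl⟩ : ∃ l : ℝ → ℝ, ∀ τ, l τ = r + q * (τ - s) := ⟨_, fun _ => rfl⟩
  have hlR : ∀ τ ∈ Icc s t', |l τ| ≤ R - 1 := by
    intro τ hτ
    have h1 : |l τ| ≤ |r| + |q * (τ - s)| := by rw [hl]; exact abs_add_le _ _
    rw [abs_of_nonneg hr, abs_mul, abs_of_nonneg (by linarith [hτ.1] : 0 ≤ τ - s)] at h1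
    have h2 : |q| * (τ - s) ≤ |q| * (t' - s) :=
      mul_le_mul_of_nonneg_left (by linarith [hτ.2]) (abs_nonneg _)
    linarith
  obtain ⟨m, hm⟩ : ∃ x, x = L i q + η := ⟨_, rfl⟩
  obtain ⟨B', hB'⟩ : ∃ x, x = |B| + |c| + |m| * (t' - s) + 1 := ⟨_, rfl⟩
  have hB'1 : 1 ≤ B' := by
    have : 0 ≤ |m| * (t' - s) := mul_nonneg (abs_nonneg _) (by linarith)
    have := abs_nonneg B
    have := abs_nonneg c
    linarith
  have hmt : ∀ τ ∈ Icc s t', B - B' + 1 ≤ c + m * (τ - s) := by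
    intro τ hτ
    have h1 : -(|m| * (t' - s)) ≤ m * (τ - s) := by
      have h2 : |m| * (τ - s) ≤ |m| * (t' - s) :=
        mul_le_mul_of_nonneg_left (by linarith [hτ.2]) (abs_nonneg _)
      have h3 := neg_abs_le (m * (τ - s))
      rw [abs_mul, abs_of_nonneg (by linarith [hτ.1] : 0 ≤ τ - s)] at h3
      linarith
    have := le_abs_self B
    have := neg_abs_le c
    linarith
  -- `M` makes the penalties exceed `B'`, hence the barrier exceed `u`, outside the region of
  -- interest. If `r = 0` the quotient `B' / r ^ 2` is `0` by convention; that bound is used only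
  -- for `r > 0`.
  obtain ⟨M, hM0, hMB, hMδ, hMr, hMt⟩ : ∃ M, 0 ≤ M ∧ B' ≤ M ∧ B' / (δ / 2) ^ 2 ≤ M ∧
      B' / r ^ 2 ≤ M ∧ B' / (t' - t) ^ 2 ≤ M := by
    have hM1 : 0 ≤ B' / (δ / 2) ^ 2 := by positivity
    have hM2 : 0 ≤ B' / r ^ 2 := by positivity
    have hM3 : 0 ≤ B' / (t' - t) ^ 2 := by positivity
    refine ⟨B' / (δ / 2) ^ 2 + B' / r ^ 2 + B' / (t' - t) ^ 2 + B', ?_, ?_, ?_, ?_, ?_⟩ <;> linarith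
  have hMx : ∀ x y : ℝ, 0 < x → x ≤ |y| → B' / x ^ 2 ≤ M → B' ≤ M * y ^ 2 := by
    intro x y hx hxy h
    rw [div_le_iff₀ (by positivity)] at h
    have : x ^ 2 ≤ y ^ 2 := by rw [← sq_abs y]; gcongr
    nlinarith
  obtain ⟨G, hG⟩ : ∃ x, x = |m| + 2 * M * (t' - t) + 2 * M * (R * |q|) := ⟨_, rfl⟩
  have hG0 : 0 ≤ G := by
    have h1 : 0 ≤ M * (t' - t) := mul_nonneg hM0 (by linarith)
    have h2 : 0 ≤ M * (R * |q|) := mul_nonneg hM0 (mul_nonneg (by linarith) (abs_nonneg _))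
    have := abs_nonneg m
    linarith
  -- On the other branches the time derivative of the barrier is at least `-G` and `H_j(k) ≥ k -
  -- L_j(1)`, so a large slope `k` makes it a strict super-solution.
  obtain ⟨k, hkB, hkδ', hkL⟩ : ∃ k, B' ≤ k ∧ B' / (δ / 2) ≤ k ∧ ∀ j, G + 1 + L j 1 ≤ k := by
    have hsum : ∀ j, L j 1 ≤ ∑ j, |L j 1| := fun j => (le_abs_self _).trans
      (Finset.single_le_sum (f := fun j => |L j 1|) (fun j _ => abs_nonneg _) (Finset.mem_univ j))
    have hsum0 : 0 ≤ ∑ j, |L j 1| := Finset.sum_nonneg fun j _ => abs_nonneg _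
    have hkδ0 : 0 ≤ B' / (δ / 2) := by positivity
    refine ⟨G + 1 + ∑ j, |L j 1| + B' / (δ / 2) + B', ?_, ?_, fun j => ?_⟩
    · linarith
    · linarith
    · linarith [hsum j]
  have hkδ : ∀ ρ, δ / 2 ≤ ρ → B' ≤ k * ρ := by
    intro ρ hρ
    rw [div_le_iff₀ (by positivity)] at hkδ'
    nlinarith
  obtain ⟨f, hfi, hfj, hfc, hit, hir, hjt, hjr⟩ := exists_segment_barrier i c m M k s t r q hl
  have hf0 : ∀ j τ, f j (τ, 0) = c + m * (τ - s) + M * max (τ - t) 0 ^ 2 + M * l τ ^ 2 := by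
    intro j τ
    by_cases hj : j = i
    · rw [hj, hfi]; ring
    · rw [hfj j hj]; ring
  obtain ⟨j, ⟨τ, ρ⟩, hz, hmax⟩ := exists_max_of_compact (K := Icc s t' ×ˢ Icc 0 R) hN hu.usc
    ⟨(s, 0), left_mem_Icc.2 (by linarith), left_mem_Icc.2 (by linarith)⟩ hKc hKs
    fun j => (hfc j).continuous.continuousOn
  obtain ⟨⟨hτs, hτt⟩, hρ0, hρR⟩ := hz
  simp only at hτs hτt hρ0 hρR
  obtain ⟨V, hV⟩ : ∃ x, x = u (τ, ρ • e j) - f j (τ, ρ) := ⟨_, rfl⟩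
  have hτK : τ ∈ Icc s t' := ⟨hτs, hτt⟩
  -- At the end of the segment the difference is `D - D / 4 - D / 4`, from the choices of `c` and
  -- `η`.
  have hVpos : 0 < V := by
    have h1 := hmax i (t, l t) ⟨⟨hst.le, htt'.le⟩, by rw [hl]; exact hr', by
      have := (le_abs_self _).trans (hlR t ⟨hst.le, htt'.le⟩)
      simp only
      linarith⟩
    rw [hfi] at h1
    simp only [sub_self, max_self] at h1
    rw [hl t] at h1
    have h2 : m * (t - s) = (t - s) * L i q + D / 4 := by rw [hm, ← hηe]; ring
    rw [← hV] at h1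
    linarith only [h1, h2, hD, hDpos, hc]
  have hBj := hB j (τ, ρ) ⟨hτK, hρ0, hρR⟩
  simp only at hBj
  have hmτ := hmt τ hτK
  have hMmax : 0 ≤ M * max (τ - t) 0 ^ 2 := by positivity
  have hMl : 0 ≤ M * l τ ^ 2 := by positivity
  have hMρ : 0 ≤ M * (ρ - l τ) ^ 2 := by positivity
  have hkρ : 0 ≤ k * ρ := mul_nonneg (by linarith) hρ0
  have hfV : f j (τ, ρ) < u (τ, ρ • e j) := by linarith
  -- the maximum point is interior
  have h_bot : s < τ := by
    refine lt_of_le_of_ne hτs fun h => ?_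
    subst h
    by_cases hj : j = i
    · subst hj
      rw [hfi] at hfV
      simp only [sub_self, mul_zero, add_zero] at hfV
      by_cases hd : |ρ - r| < δ
      · have := hδ1 ρ hρ0 hd
        linarith
      · have := hMx (δ / 2) (ρ - l s) (by positivity)
          (by simp only [hl, sub_self, mul_zero, add_zero]; linarith) hMδ
        linarith
    · rw [hfj j hj] at hfV
      simp only [sub_self, mul_zero, add_zero] at hfV
      by_cases hd : ρ + r < δ
      · have := hδ2 j ρ hρ0 hd
        linarith
      · rcases le_total (δ / 2) ρ with h | h
        · have := hkδ ρ h
          linarith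
        · have := hMx (δ / 2) (l s) (by positivity)
            (by simp only [hl, sub_self, mul_zero, add_zero]; rw [abs_of_nonneg hr]; linarith)
            hMδ
          linarith
  have h_top : τ < t' := by
    refine lt_of_le_of_ne hτt fun h => ?_
    have h1 := hMx (t' - t) (max (τ - t) 0) (by linarith)
      (by rw [h, max_eq_left (by linarith), abs_of_nonneg (by linarith)]) hMt
    by_cases hj : j = i
    · subst hj
      rw [hfi] at hfV
      simp only at hfV
      linarith
    · rw [hfj j hj] at hfV
      simp only at hfV
      linarith
  have h_side : ρ < R := by
    refine lt_of_le_of_ne hρR fun h => ?_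
    by_cases hj : j = i
    · subst hj
      rw [hfi] at hfV
      simp only at hfV
      have h2 := le_abs_self (l τ)
      have h3 := hlR τ hτK
      have h1 := hMx 1 (ρ - l τ) one_pos
        (by rw [abs_of_nonneg (by linarith)]; linarith) (by simpa using hMB)
      linarith
    · rw [hfj j hj] at hfV
      simp only at hfV
      nlinarith
  have hτT : τ ∈ Ioo 0 T := ⟨hs.trans h_bot, h_top.trans ht'T⟩
  have hmax0 : 0 ≤ 2 * M * max (τ - t) 0 := by positivity
  have hfV' : u (τ, ρ • e j) = V + f j (τ, ρ) := by rw [hV]; ring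
  rcases hρ0.eq_or_lt with h0 | hρpos
  · subst h0
    -- For `q > 0` the segment stays at distance at least `r > 0` from the origin, where the
    -- parabola already exceeds `u`.
    have hq : q ≤ 0 := by
      by_contra! hq'
      have hr0 := hq.resolve_left hq'.not_ge
      rw [hf0] at hfV
      have h1 : r ≤ l τ := by
        simp only [hl]
        nlinarith
      have := hMx r (l τ) hr0 (by rw [abs_of_nonneg (by linarith)]; exact h1) hMr
      linarith
    have hz0 : ∀ j' : Fin N, u (τ, (0 : ℝ) • e j') = u (τ, 0) := by simp
    classical
    have h1 := hu.junction_ineq he he_inj hN (f := fun j z => V + f j z) (t := τ) (t₁ := T)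
      (a := m + 2 * M * max (τ - t) 0 + 2 * M * (0 - l τ) * (-q))
      (p := fun j => if j = i then 2 * M * (0 - l τ) else k) hτT hτT.2
      (fun a b s => by simp only [hf0]) (fun a => (contDiff_const.add (hfc a)).contDiffOn)
      (fun a => ?_) (fun a => ?_) (fun a => ?_) (fun a => ?_) i
    · simp only [if_true] at h1
      have h2 := (hL i).le_hamNeg (2 * M * (0 - l τ)) hq
      linarith
    · by_cases ha : a = i
      · rw [ha]
        exact (hit τ 0).const_add V
      · exact (hjt a ha τ 0).const_add V
    · by_cases ha : a = i
      · simp only [ha, if_true]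
        exact (hir τ 0).const_add V
      · simp only [if_neg ha]
        exact (hjr a ha τ 0).const_add V
    · have : Icc s t' ×ˢ Iio R ∈ 𝓝 (τ, (0 : ℝ)) :=
        prod_mem_nhds (Icc_mem_nhds h_bot h_top) (Iio_mem_nhds (by linarith))
      filter_upwards [this] with z hz hz0
      linarith [hmax a z ⟨hz.1, hz0, hz.2.le⟩]
    · rw [← hz0 j, hfV', hf0, hf0]
  · have hnear : ∀ᶠ z in 𝓝 (τ, ρ), u (z.1, z.2 • e j) ≤ V + f j z := by
      have : Icc s t' ×ˢ Icc 0 R ∈ 𝓝 (τ, ρ) :=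
        prod_mem_nhds (Icc_mem_nhds h_bot h_top) (Icc_mem_nhds hρpos h_side)
      filter_upwards [this] with z hz
      linarith [hmax j z hz]
    by_cases hj : j = i
    · subst hj
      have h1 := hu.branch_ineq he he_inj (f := fun z => V + f j z) (t₁ := T) hτT hτT.2 hρpos
        (contDiff_const.add (hfc j)).contDiffOn ((hit τ ρ).const_add V) ((hir τ ρ).const_add V)
        hnear hfV'
      have h2 := (hL j).le_ham (2 * M * (ρ - l τ)) q
      linarith
    · have h1 := hu.branch_ineq he he_inj (f := fun z => V + f j z) (t₁ := T) hτT hτT.2 hρpos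
        (contDiff_const.add (hfc j)).contDiffOn ((hjt j hj τ ρ).const_add V)
        ((hjr j hj τ ρ).const_add V) hnear hfV'
      have h2 := (hL j).le_ham k 1
      have h3 := hkL j
      have h4 : -(2 * M * (R * |q|)) ≤ 2 * M * (0 - l τ) * (-q) := by
        have h5 : |l τ| * |q| ≤ R * |q| :=
          mul_le_mul_of_nonneg_right (by linarith [hlR τ hτK]) (abs_nonneg _)
        have h6 := neg_abs_le (l τ * q)
        rw [abs_mul] at h6
        nlinarith
      have h7 := neg_abs_le m
      have h8 : 0 ≤ M * (t' - t) := mul_nonneg hM0 (by linarith)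
      linarith

end Subsolution

/-! ### Polygonal trajectories and the comparison of sub-solutions with the value function -/

/-- `Reach e L u₀ t x c`: some polygonal trajectory ends at `x` at time `t` with total cost `c`,
the initial cost being `u₀`. -/
inductive Reach (e : Fin N → Plane) (L : Fin N → ℝ → ℝ) (u₀ : Plane → ℝ) :
    ℝ → Plane → ℝ → Prop
  | start {x : Plane} (hx : x ∈ junction e) : Reach e L u₀ 0 x (u₀ x)
  | step {s t r r' c : ℝ} (i : Fin N) (hst : s < t) (hr : 0 ≤ r) (hr' : 0 ≤ r')
      (h : Reach e L u₀ s (r • e i) c) :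
      Reach e L u₀ t (r' • e i) (c + (t - s) * L i ((r' - r) / (t - s)))

/-- The value function of the optimal control problem on the junction. -/
noncomputable def value (e : Fin N → Plane) (L : Fin N → ℝ → ℝ) (u₀ : Plane → ℝ)
    (P : ℝ × Plane) : ℝ :=
  sInf {c | Reach e L u₀ P.1 P.2 c}

section Comparison

variable {e : Fin N → Plane} (he : ∀ i, ‖e i‖ = 1) (he_inj : Function.Injective e)
  {L : Fin N → ℝ → ℝ} (hL : ∀ i, IsLagrangian (L i)) {T : ℝ} {u : ℝ × Plane → ℝ}
  {u₀ : Plane → ℝ}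

include he he_inj hL

/-- Starting at a time `τ` in `(s, t)` satisfies the positivity conditions of `segment_of_pos`, even
if `s = 0` or the segment leaves the origin. Upper semicontinuity then allows `τ → s`. -/
theorem IsSubsolution.segment (hN : 1 ≤ N) (hu : IsSubsolution e L T u) {i : Fin N}
    {s t r q : ℝ} (hs : 0 ≤ s) (hst : s < t) (htT : t < T) (hr : 0 ≤ r)
    (hr' : 0 ≤ r + q * (t - s)) :
    u (t, (r + q * (t - s)) • e i) ≤ u (s, r • e i) + (t - s) * L i q := by
  have hpos : ∀ τ ∈ Ioo s t, u (t, (r + q * (t - s)) • e i) ≤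
      u (τ, (r + q * (τ - s)) • e i) + (t - τ) * L i q := by
    intro τ hτ
    have h0 : r + q * (t - s) = r + q * (τ - s) + q * (t - τ) := by ring
    have h1 : q ≤ 0 ∨ 0 < r + q * (τ - s) := by
      rcases le_or_gt q 0 with h | h
      · exact Or.inl h
      · exact Or.inr (by nlinarith [hτ.1])
    have h2 : 0 ≤ r + q * (τ - s) := by
      rcases h1 with h | h
      · nlinarith [hτ.2]
      · exact h.le
    rw [h0] at hr' ⊢
    exact hu.segment_of_pos he he_inj hL hN (hs.trans_lt hτ.1) hτ.2 htT h2 hr' h1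
  refine le_of_forall_pos_le_add fun ε hε => ?_
  have hc : Tendsto (fun τ : ℝ => ((τ, (r + q * (τ - s)) • e i) : ℝ × Plane)) (𝓝[Ioo s t] s)
      (𝓝[cyl e T] (s, r • e i)) := by
    refine tendsto_nhdsWithin_iff.2 ⟨?_, ?_⟩
    · have : Continuous fun τ : ℝ => ((τ, (r + q * (τ - s)) • e i) : ℝ × Plane) := by fun_prop
      have h := this.tendsto s
      simp only [sub_self, mul_zero, add_zero] at h
      exact h.mono_left nhdsWithin_le_nhds
    · refine eventually_nhdsWithin_of_forall fun τ hτ => ⟨⟨hs.trans hτ.1.le, hτ.2.trans htT⟩,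
        smul_mem_junction i ?_⟩
      rcases le_or_gt q 0 with h | h
      · nlinarith [hτ.2]
      · nlinarith [hτ.1]
  have h1 : ∀ᶠ τ in 𝓝[Ioo s t] s,
      u (τ, (r + q * (τ - s)) • e i) < u (s, r • e i) + ε / 2 :=
    hc.eventually (hu.usc (s, r • e i) ⟨⟨hs, hst.trans htT⟩, smul_mem_junction i hr⟩ _
      (by linarith))
  have h2 : ∀ᶠ τ in 𝓝[Ioo s t] s, (t - τ) * L i q < (t - s) * L i q + ε / 2 := by
    have : Continuous fun τ : ℝ => (t - τ) * L i q := by fun_prop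
    exact (this.tendsto s).mono_left nhdsWithin_le_nhds |>.eventually_lt_const (by linarith)
  have : (𝓝[Ioo s t] s).NeBot := left_nhdsWithin_Ioo_neBot hst
  obtain ⟨τ, h3, h4, h5⟩ := (h1.and (h2.and self_mem_nhdsWithin)).exists
  linarith [hpos τ h5]

omit he he_inj hL in
theorem Reach.time_nonneg {t : ℝ} {x : Plane} {c : ℝ} (h : Reach e L u₀ t x c) : 0 ≤ t := by
  induction h with
  | start => exact le_rfl
  | step i hst hr hr' h ih => linarith

theorem IsSubsolution.le_of_reach (hN : 1 ≤ N) (hu : IsSubsolution e L T u)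
    (h0 : ∀ x ∈ junction e, u (0, x) ≤ u₀ x) {t : ℝ} {x : Plane} {c : ℝ}
    (h : Reach e L u₀ t x c) (ht : t < T) : u (t, x) ≤ c := by
  induction h with
  | start hx => exact h0 _ hx
  | @step s t r r' c i hst hr hr' h ih =>
    have hts : t - s ≠ 0 := by linarith
    have h1 : r + (r' - r) / (t - s) * (t - s) = r' := by rw [div_mul_cancel₀ _ hts]; ring
    have h2 := hu.segment he he_inj hL hN (i := i) (q := (r' - r) / (t - s)) h.time_nonneg hst ht hr
      (by rw [h1]; exact hr')
    rw [h1] at h2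
    linarith [ih (hst.trans ht)]

end Comparison

/-! ### Bounds and Lipschitz regularity of the value function -/

section Value

variable {e : Fin N → Plane} (he : ∀ i, ‖e i‖ = 1) {L : Fin N → ℝ → ℝ} {u₀ : Plane → ℝ}

theorem exists_reach {t : ℝ} (ht : 0 ≤ t) {i : Fin N} {r : ℝ} (hr : 0 ≤ r) :
    ∃ c, Reach e L u₀ t (r • e i) c ∧ c = u₀ (r • e i) + t * L i 0 := by
  have h := Reach.start (L := L) (u₀ := u₀) (smul_mem_junction (e := e) i hr)
  rcases ht.eq_or_lt with rfl | ht
  · exact ⟨_, h, by simp⟩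
  · exact ⟨_, Reach.step i ht hr hr h, by simp⟩

variable {K C : ℝ} (hC0 : 0 ≤ C) (hC : ∀ i q, K * |q| ≤ L i q + C)
  (hu₀ : ∀ i r r', 0 ≤ r → 0 ≤ r' → |u₀ (r • e i) - u₀ (r' • e i)| ≤ K * |r - r'|)

include hC hu₀

/-- A segment costs at least `K` times its length minus `C` times its duration, and `u₀` is
`K`-Lipschitz along branches. -/
theorem Reach.initial_sub_le {t : ℝ} {x : Plane} {c : ℝ} (h : Reach e L u₀ t x c) :
    u₀ x - C * t ≤ c := by
  induction h with
  | start hx => simp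
  | @step s t r r' c i hst hr hr' h ih =>
    have hts : 0 < t - s := by linarith
    have h1 := hC i ((r' - r) / (t - s))
    rw [abs_div, abs_of_pos hts] at h1
    have h2 := mul_le_mul_of_nonneg_left h1 hts.le
    have h3 : (t - s) * (K * (|r' - r| / (t - s))) = K * |r' - r| := by field_simp
    have h4 := (le_abs_self _).trans (hu₀ i r' r hr' hr)
    linarith

theorem bddBelow_reach (t : ℝ) (x : Plane) : BddBelow {c | Reach e L u₀ t x c} :=
  ⟨u₀ x - C * t, fun _ h => Reach.initial_sub_le hC hu₀ h⟩

theorem value_le {t : ℝ} {x : Plane} {c : ℝ} (h : Reach e L u₀ t x c) :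
    value e L u₀ (t, x) ≤ c := csInf_le (bddBelow_reach hC hu₀ t x) h

omit hC hu₀ in
theorem le_value {t : ℝ} (ht : 0 ≤ t) {x : Plane} (hx : x ∈ junction e) {d : ℝ}
    (h : ∀ c, Reach e L u₀ t x c → d ≤ c) : d ≤ value e L u₀ (t, x) := by
  obtain ⟨i, r, hr, rfl⟩ := exists_eq_smul hx
  obtain ⟨c, hc, -⟩ := exists_reach (L := L) (u₀ := u₀) (e := e) ht (i := i) hr
  exact le_csInf ⟨c, hc⟩ h

theorem initial_sub_le_value {t : ℝ} (ht : 0 ≤ t) {x : Plane} (hx : x ∈ junction e) :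
    u₀ x - C * t ≤ value e L u₀ (t, x) :=
  le_value ht hx fun _ h => Reach.initial_sub_le hC hu₀ h

theorem value_zero {x : Plane} (hx : x ∈ junction e) : value e L u₀ (0, x) = u₀ x :=
  le_antisymm (value_le hC hu₀ (Reach.start hx))
    (by simpa using initial_sub_le_value hC hu₀ le_rfl hx)

theorem value_segment {i : Fin N} {s t r r' : ℝ} (hs : 0 ≤ s) (hst : s < t) (hr : 0 ≤ r)
    (hr' : 0 ≤ r') : value e L u₀ (t, r' • e i) ≤
      value e L u₀ (s, r • e i) + (t - s) * L i ((r' - r) / (t - s)) := by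
  rw [← sub_le_iff_le_add]
  refine le_value hs (smul_mem_junction i hr) fun c hc => ?_
  rw [sub_le_iff_le_add]
  exact value_le hC hu₀ (hc.step i hst hr hr')

/-- Drop the first `η` units of time and start afresh, at time `0`, from the point reached at time
`η`. By `Reach.initial_sub_le` the dropped part cost at least `u₀` there minus `C * η`. -/
theorem Reach.exists_earlier {t : ℝ} {x : Plane} {c : ℝ} (h : Reach e L u₀ t x c) :
    ∀ η, 0 ≤ η → η ≤ t → ∃ c', Reach e L u₀ (t - η) x c' ∧ c' ≤ c + C * η := by
  induction h with
  | @start x hx =>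
    intro η h0 h1
    obtain rfl : η = 0 := le_antisymm h1 h0
    exact ⟨u₀ x, by simpa using Reach.start hx, by simp⟩
  | @step s t r r' c i hst hr hr' h ih =>
    intro η h0 h1
    have hts : 0 < t - s := by linarith
    rcases le_or_gt η s with hs | hs
    · obtain ⟨c', hc', hle⟩ := ih η h0 hs
      have := hc'.step i (by linarith : s - η < t - η) hr hr'
      rw [sub_sub_sub_cancel_right] at this
      exact ⟨_, this, by linarith⟩
    · rcases h1.eq_or_lt with rfl | h1
      · refine ⟨u₀ (r' • e i), by simpa using Reach.start (smul_mem_junction i hr'), ?_⟩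
        linarith [Reach.initial_sub_le hC hu₀ (h.step i hst hr hr')]
      · obtain ⟨q, hq⟩ : ∃ q, q = (r' - r) / (t - s) := ⟨_, rfl⟩
        have hq' : r' - r = q * (t - s) := by rw [hq, div_mul_cancel₀ _ hts.ne']
        have hz : 0 ≤ r + q * (η - s) := by
          rcases le_or_gt q 0 with h | h <;> nlinarith
        have h2 := Reach.initial_sub_le hC hu₀ (h.step i hs hr hz)
        have h3 := (Reach.start (L := L) (u₀ := u₀) (smul_mem_junction (e := e) i hz)).step i
          (by linarith : (0 : ℝ) < t - η) hz hr'
        have h4 : (r + q * (η - s) - r) / (η - s) = q := by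
          rw [add_sub_cancel_left, mul_div_cancel_right₀ _ (by linarith)]
        have h5 : (r' - (r + q * (η - s))) / (t - η - 0) = q := by
          rw [div_eq_iff (by linarith)]
          linear_combination hq'
        rw [h4] at h2
        rw [h5] at h3
        refine ⟨_, h3, ?_⟩
        rw [← hq]
        linarith

variable (hC1 : ∀ i q, |q| ≤ 1 → L i q ≤ C)

theorem value_sub_le_value {s t : ℝ} (hs : 0 ≤ s) (hst : s ≤ t) {x : Plane}
    (hx : x ∈ junction e) : value e L u₀ (s, x) - C * (t - s) ≤ value e L u₀ (t, x) := by
  refine le_value (hs.trans hst) hx fun c hc => ?_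
  obtain ⟨c', hc', h⟩ := Reach.exists_earlier hC hu₀ hc (t - s) (by linarith) (by linarith)
  rw [sub_sub_cancel] at hc'
  linarith [value_le hC hu₀ hc']

include hC1

theorem value_le_initial_add {t : ℝ} (ht : 0 ≤ t) {x : Plane} (hx : x ∈ junction e) :
    value e L u₀ (t, x) ≤ u₀ x + C * t := by
  obtain ⟨i, r, hr, rfl⟩ := exists_eq_smul hx
  obtain ⟨c, hc, rfl⟩ := exists_reach (L := L) (u₀ := u₀) ht (i := i) hr
  have := mul_le_mul_of_nonneg_left (hC1 i 0 (by simp)) ht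
  linarith [value_le hC hu₀ hc]

theorem abs_value_time_sub_le {s t : ℝ} (hs : 0 ≤ s) (ht : 0 ≤ t) {x : Plane}
    (hx : x ∈ junction e) : |value e L u₀ (t, x) - value e L u₀ (s, x)| ≤ C * |t - s| := by
  wlog hst : s ≤ t generalizing s t
  · rw [abs_sub_comm, abs_sub_comm t]
    exact this ht hs (le_of_not_ge hst)
  have h1 := value_sub_le_value hC hu₀ hs hst hx
  rw [abs_of_nonneg (by linarith : 0 ≤ t - s), abs_le]
  refine ⟨by linarith, ?_⟩
  rcases hst.eq_or_lt with rfl | hst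
  · simp
  obtain ⟨i, r, hr, rfl⟩ := exists_eq_smul hx
  have h2 := value_segment hC hu₀ (i := i) hs hst hr hr
  have h3 : (t - s) * L i ((r - r) / (t - s)) ≤ (t - s) * C :=
    mul_le_mul_of_nonneg_left (hC1 i _ (by simp)) (by linarith)
  linarith

include hC0

/-- Move from `r` to `r'` at unit speed, starting at time `t - |r' - r|`; the lost time costs a
further `C * |r' - r|`. If `t` is too short for this, both values are close to `u₀`. -/
theorem value_space_le (hK : 0 ≤ K) {t r r' : ℝ} {i : Fin N} (ht : 0 ≤ t) (hr : 0 ≤ r)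
    (hr' : 0 ≤ r') :
    value e L u₀ (t, r' • e i) ≤ value e L u₀ (t, r • e i) + (K + 2 * C) * |r' - r| := by
  obtain ⟨η, hη⟩ : ∃ η, η = |r' - r| := ⟨_, rfl⟩
  have hη0 : 0 ≤ η := hη ▸ abs_nonneg _
  have hKη : 0 ≤ K * η := mul_nonneg hK hη0
  rw [← hη]
  rcases hη0.eq_or_lt with h0 | h0
  · rw [← h0] at hη
    rw [sub_eq_zero.1 (abs_eq_zero.1 hη.symm), ← h0]
    simp
  rcases le_or_gt η t with h | h
  · have h1 := value_segment hC hu₀ (i := i) (s := t - η) (t := t) (by linarith) (by linarith) hr hr'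
    rw [sub_sub_cancel] at h1
    have h2 := mul_le_mul_of_nonneg_left (hC1 i ((r' - r) / η) (by
      rw [abs_div, abs_of_pos h0, ← hη, div_self h0.ne'])) hη0
    have h3 := value_sub_le_value hC hu₀ (by linarith : 0 ≤ t - η) (by linarith : t - η ≤ t)
      (smul_mem_junction (e := e) i hr)
    linarith
  · have h1 := value_le_initial_add hC hu₀ hC1 ht (smul_mem_junction (e := e) i hr')
    have h2 := initial_sub_le_value hC hu₀ ht (smul_mem_junction (e := e) i hr)
    have h3 := (le_abs_self _).trans (hu₀ i r' r hr' hr)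
    rw [← hη] at h3
    have h4 : C * t ≤ C * η := by gcongr
    linarith

theorem abs_value_sub_le (hK : 0 ≤ K) {s t r r' : ℝ} {i : Fin N} (hs : 0 ≤ s) (ht : 0 ≤ t)
    (hr : 0 ≤ r) (hr' : 0 ≤ r') :
    |value e L u₀ (t, r • e i) - value e L u₀ (s, r' • e i)| ≤
      (K + 2 * C) * (|t - s| + |r - r'|) := by
  have h1 := abs_value_time_sub_le hC hu₀ hC1 hs ht (smul_mem_junction (e := e) i hr)
  have h2 := value_space_le hC0 hC hu₀ hC1 hK (i := i) hs hr hr'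
  have h3 := value_space_le hC0 hC hu₀ hC1 hK (i := i) hs hr' hr
  rw [abs_sub_comm r' r] at h2
  rw [abs_le] at h1 ⊢
  have h4 : C * |t - s| ≤ (K + 2 * C) * |t - s| := by gcongr; linarith
  rw [mul_add]
  constructor <;> linarith

include he in
theorem abs_value_sub_le_geodDist (hK : 0 ≤ K) {s t : ℝ} (hs : 0 ≤ s) (ht : 0 ≤ t) {x y : Plane}
    (hx : x ∈ junction e) (hy : y ∈ junction e) :
    |value e L u₀ (t, x) - value e L u₀ (s, y)| ≤
      (K + 2 * C) * (|t - s| + geodDist e x y) := by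
  rw [geodDist]
  split_ifs with h
  · obtain ⟨i, ⟨r, hr, rfl⟩, r', hr', rfl⟩ := h
    rw [← sub_smul, norm_smul, he, mul_one]
    exact abs_value_sub_le hC0 hC hu₀ hC1 hK hs ht hr hr'
  · obtain ⟨i, r, hr, rfl⟩ := exists_eq_smul hx
    obtain ⟨j, r', hr', rfl⟩ := exists_eq_smul hy
    have h1 := abs_value_sub_le hC0 hC hu₀ hC1 hK (i := i) hs ht hr le_rfl
    have h2 := abs_value_sub_le hC0 hC hu₀ hC1 hK (i := j) hs hs le_rfl hr'
    rw [norm_smul_unit he i hr, norm_smul_unit he j hr']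
    simp only [zero_smul, sub_zero, zero_sub, abs_neg, sub_self, abs_zero, zero_add,
      abs_of_nonneg hr, abs_of_nonneg hr'] at h1 h2
    calc _ ≤ _ := abs_sub_le _ (value e L u₀ (s, 0)) _
      _ ≤ _ := by linarith

include he in
theorem continuousOn_value (hK : 0 ≤ K) (T : ℝ) : ContinuousOn (value e L u₀) (cyl e T) := by
  refine continuousOn_prod_junction he fun i => ?_
  rintro ⟨s, r'⟩ ⟨hs, hr'⟩
  refine tendsto_iff_norm_sub_tendsto_zero.2 ?_
  have hlim : Tendsto (fun z : ℝ × ℝ => (K + 2 * C) * (|z.1 - s| + |z.2 - r'|))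
      (𝓝[Ico 0 T ×ˢ Ici 0] (s, r')) (𝓝 0) := by
    have : Continuous fun z : ℝ × ℝ => (K + 2 * C) * (|z.1 - s| + |z.2 - r'|) := by fun_prop
    have h := this.tendsto (s, r')
    simp only [sub_self, abs_zero, add_zero, mul_zero] at h
    exact h.mono_left nhdsWithin_le_nhds
  refine squeeze_zero' (Eventually.of_forall fun _ => norm_nonneg _) ?_ hlim
  exact eventually_nhdsWithin_of_forall fun z hz =>
    abs_value_sub_le hC0 hC hu₀ hC1 hK hs.1 hz.1.1 hz.2 hr'

end Value

/-! ### The value function is a sub-solution -/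

section Expansion

variable {e : Fin N → Plane} {T : ℝ} {φ : ℝ × Plane → ℝ}

theorem IsTest.expansion (hφ : IsTest e T φ) {t r : ℝ} (ht : t ∈ Ioo 0 T) (hr : 0 ≤ r)
    (i : Fin N) {ε : ℝ} (hε : 0 < ε) :
    ∀ᶠ z in 𝓝[Ioo 0 T ×ˢ Ici 0] (t, r), |φ (z.1, z.2 • e i) - φ (t, r • e i) -
      timeDeriv φ t (r • e i) * (z.1 - t) - branchDeriv e φ i t r * (z.2 - r)| ≤
        ε * (|z.1 - t| + |z.2 - r|) := by
  obtain ⟨D, hD⟩ : ∃ D, HasFDerivWithinAt (fun p : ℝ × ℝ => φ (p.1, p.2 • e i)) D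
      (Ioo 0 T ×ˢ Ici 0) (t, r) :=
    ⟨_, ((hφ.contDiffOn i).differentiableOn (by norm_num) (t, r)
      (mk_mem_prod ht hr)).hasFDerivWithinAt⟩
  have ha : timeDeriv φ t (r • e i) = D (1, 0) := by
    have h1 : HasDerivWithinAt (fun s : ℝ => (s, r)) ((1 : ℝ), (0 : ℝ)) (Ioo 0 T) t :=
      ((hasDerivAt_id t).prodMk (hasDerivAt_const t r)).hasDerivWithinAt
    have h2 := hD.comp_hasDerivWithinAt t h1 fun s hs => mk_mem_prod hs hr
    exact (h2.hasDerivAt (Ioo_mem_nhds ht.1 ht.2)).deriv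
  have hp : branchDeriv e φ i t r = D (0, 1) := by
    have h1 : HasDerivWithinAt (fun ρ : ℝ => (t, ρ)) ((0 : ℝ), (1 : ℝ)) (Ici 0) r :=
      ((hasDerivAt_const r t).prodMk (hasDerivAt_id r)).hasDerivWithinAt
    have h2 := hD.comp_hasDerivWithinAt r h1 fun s hs => mk_mem_prod ht hs
    exact h2.derivWithin (uniqueDiffOn_Ici 0 r hr)
  filter_upwards [hD.isLittleO.bound hε] with z hz
  have h3 : D (z - (t, r)) = D (1, 0) * (z.1 - t) + D (0, 1) * (z.2 - r) := by
    have : z - (t, r) = (z.1 - t) • ((1 : ℝ), (0 : ℝ)) + (z.2 - r) • ((0 : ℝ), (1 : ℝ)) := by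
      ext <;> simp
    rw [this, map_add, map_smul, map_smul, smul_eq_mul, smul_eq_mul]
    ring
  rw [h3, Real.norm_eq_abs] at hz
  rw [ha, hp, sub_sub]
  refine hz.trans (mul_le_mul_of_nonneg_left ?_ hε.le)
  rw [Prod.norm_def]
  exact max_le_add_of_nonneg (abs_nonneg _) (abs_nonneg _)

theorem tendsto_branch_coord (i : Fin N) (t r : ℝ) :
    Tendsto (fun z : ℝ × ℝ => ((z.1, z.2 • e i) : ℝ × Plane)) (𝓝[Ioo 0 T ×ˢ Ici 0] (t, r))
      (𝓝[openCyl e T] (t, r • e i)) :=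
  tendsto_nhdsWithin_iff.2
    ⟨((continuous_branch_coord i).tendsto (t, r)).mono_left nhdsWithin_le_nhds,
      eventually_nhdsWithin_of_forall fun _ hz => ⟨hz.1, smul_mem_junction i hz.2⟩⟩

end Expansion

section ValueSub

variable {e : Fin N → Plane} {L : Fin N → ℝ → ℝ} {T : ℝ} {u φ : ℝ × Plane → ℝ}

/-- A function that grows along segments at most by their cost satisfies the sub-solution
inequality for every admissible speed. -/
theorem deriv_le_of_segment {i : Fin N}
    (hu : ∀ s t r r', 0 < s → s < t → 0 ≤ r → 0 ≤ r' →
      u (t, r' • e i) ≤ u (s, r • e i) + (t - s) * L i ((r' - r) / (t - s)))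
    (hφ : IsTest e T φ) {t r q : ℝ} (ht : t ∈ Ioo 0 T) (hr : 0 ≤ r)
    (h : TouchesFromAbove e T φ u (t, r • e i)) (hq : q ≤ 0 ∨ 0 < r) :
    timeDeriv φ t (r • e i) + (branchDeriv e φ i t r * q - L i q) ≤ 0 := by
  refine le_of_forall_pos_le_add fun ε hε => ?_
  obtain ⟨ε', hε', hε''⟩ : ∃ ε' > 0, ε' * (1 + |q|) = ε :=
    ⟨ε / (1 + |q|), by positivity, by field_simp⟩
  -- Look backwards along the segment of speed `q`; `hq` keeps it in the branch for small `η`.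
  have hc : Tendsto (fun η : ℝ => (t - η, r - q * η)) (𝓝[>] 0) (𝓝[Ioo 0 T ×ˢ Ici 0] (t, r)) := by
    have hcont : Continuous fun η : ℝ => (t - η, r - q * η) := by fun_prop
    refine tendsto_nhdsWithin_iff.2 ⟨?_, ?_⟩
    · have h := hcont.tendsto 0
      simp only [sub_zero, mul_zero] at h
      exact h.mono_left nhdsWithin_le_nhds
    · have h1 : ∀ᶠ η : ℝ in 𝓝[>] 0, η < t := nhdsWithin_le_nhds (Iio_mem_nhds ht.1)
      have h2 : ∀ᶠ η : ℝ in 𝓝[>] 0, 0 ≤ r - q * η := by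
        rcases hq with hq | hq
        · filter_upwards [self_mem_nhdsWithin] with η hη
          have : (0 : ℝ) < η := hη
          nlinarith
        · have : Continuous fun η : ℝ => r - q * η := by fun_prop
          have h := (this.tendsto 0).mono_left (nhdsWithin_le_nhds (s := Ioi 0))
          simp only [mul_zero, sub_zero] at h
          filter_upwards [h.eventually_const_lt hq] with η hη using hη.le
      filter_upwards [h1, h2, self_mem_nhdsWithin] with η h1 h2 h3
      have : (0 : ℝ) < η := h3
      exact ⟨⟨by linarith, by linarith [ht.2]⟩, h2⟩
  obtain ⟨η, hexp, htouch, hmem, hη⟩ := ((hc.eventually (hφ.expansion ht hr i hε')).and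
    ((hc.eventually ((tendsto_branch_coord i t r).eventually h.1)).and
      ((hc.eventually self_mem_nhdsWithin).and self_mem_nhdsWithin))).exists
  have hη : 0 < η := hη
  simp only at hexp htouch
  have h1 := hu (t - η) t (r - q * η) r hmem.1.1 (by linarith) hmem.2 hr
  rw [sub_sub_cancel, sub_sub_cancel, mul_div_cancel_right₀ _ hη.ne'] at h1
  rw [sub_sub_cancel_left, sub_sub_cancel_left, abs_neg, abs_neg, abs_mul, abs_of_pos hη] at hexp
  have h2 := h.2
  have h3 := (abs_le.1 hexp).2
  have h4 : η * (timeDeriv φ t (r • e i) + (branchDeriv e φ i t r * q - L i q)) ≤ η * ε := by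
    rw [← hε'']
    linarith
  rw [zero_add]
  exact le_of_mul_le_mul_left h4 hη

theorem isSubsolution_of_segment (hN : 1 ≤ N) (huc : UpperSemicontinuousOn u (cyl e T))
    (hu : ∀ i s t r r', 0 < s → s < t → 0 ≤ r → 0 ≤ r' →
      u (t, r' • e i) ≤ u (s, r • e i) + (t - s) * L i ((r' - r) / (t - s))) :
    IsSubsolution e L T u := by
  have : Nonempty (Fin N) := ⟨⟨0, hN⟩⟩
  refine ⟨huc, fun φ hφ t ht i r hr h => ?_, fun φ hφ t ht h => ?_⟩
  · rw [← le_neg_iff_add_nonpos_left]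
    refine IsLagrangian.ham_le fun q => ?_
    linarith [deriv_le_of_segment (hu i) hφ ht hr.le h (q := q) (Or.inr hr)]
  · rw [← le_neg_iff_add_nonpos_left]
    refine ciSup_le fun i => IsLagrangian.hamNeg_le fun q hq => ?_
    rw [← zero_smul ℝ (e i)] at h
    have := deriv_le_of_segment (hu i) hφ ht le_rfl h (q := q) (Or.inl hq)
    rw [zero_smul] at this
    linarith

end ValueSub

/-! ### The value function is a super-solution -/

section ValueSuper

variable {e : Fin N → Plane} (he : ∀ i, ‖e i‖ = 1) (he_inj : Function.Injective e)
  {L : Fin N → ℝ → ℝ} {T : ℝ} {u₀ : Plane → ℝ} {K C : ℝ}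
  (hC : ∀ i q, K * |q| ≤ L i q + C)
  (hu₀ : ∀ i r r', 0 ≤ r → 0 ≤ r' → |u₀ (r • e i) - u₀ (r' • e i)| ≤ K * |r - r'|)

include hC hu₀

/-- If `ψ + δ` lies below the value function on the boundary of a backward neighbourhood of
`(t, x)` in which `ψ` grows at most by the cost of segments, then so it does at `(t, x)`. -/
theorem add_le_value_of_boundary {ψ : ℝ × Plane → ℝ} {t δ ρ : ℝ} {x : Plane} (ht : 0 ≤ t)
    (hx : x ∈ junction e) (hρ0 : 0 ≤ ρ) (hρ : ρ < t)
    (hseg : ∀ i s s' r r', 0 ≤ s → s < s' → s' ≤ t → 0 ≤ r → 0 ≤ r' →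
      t - s + ‖r • e i - x‖ ≤ ρ → t - s' + ‖r' • e i - x‖ ≤ ρ →
        ψ (s', r' • e i) ≤ ψ (s, r • e i) + (s' - s) * L i ((r' - r) / (s' - s)))
    (hbd : ∀ s y, 0 ≤ s → s ≤ t → y ∈ junction e → t - s + ‖y - x‖ = ρ →
      ψ (s, y) + δ ≤ value e L u₀ (s, y)) : ψ (t, x) + δ ≤ value e L u₀ (t, x) := by
  have key : ∀ s y c, Reach e L u₀ s y c → s ≤ t → t - s + ‖y - x‖ ≤ ρ → ψ (s, y) + δ ≤ c := by
    intro s y c h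
    induction h with
    | start hy =>
      intro _ h2
      -- Since `ρ < t`, the neighbourhood does not reach time `0`, so no trajectory starts in it.
      linarith [norm_nonneg (‹Plane› - x)]
    | @step s s' r r' c i hst hr hr' h ih =>
      intro h1 h2
      have hs := h.time_nonneg
      have hss : 0 < s' - s := by linarith
      rcases le_or_gt (t - s + ‖r • e i - x‖) ρ with h3 | h3
      · linarith [ih (by linarith) h3, hseg i s s' r r' hs hst h1 hr hr' h3 h2]
      obtain ⟨q, hq⟩ : ∃ q, q = (r' - r) / (s' - s) := ⟨_, rfl⟩
      have hq' : r' = r + q * (s' - s) := by rw [hq, div_mul_cancel₀ _ hss.ne']; ring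
      have hcont : ContinuousOn (fun τ => t - τ + ‖(r + q * (τ - s)) • e i - x‖) (Icc s s') := by
        fun_prop
      have hmem : ρ ∈ Icc (t - s' + ‖(r + q * (s' - s)) • e i - x‖)
          (t - s + ‖(r + q * (s - s)) • e i - x‖) := by
        rw [← hq', sub_self, mul_zero, add_zero]
        exact ⟨h2, h3.le⟩
      -- The last segment comes from outside: cut it where it crosses the boundary.
      obtain ⟨τ, hτ, hτρ⟩ := intermediate_value_Icc' hst.le hcont hmem
      simp only at hτρ
      have hz : 0 ≤ r + q * (τ - s) := by
        rcases le_or_gt q 0 with h | h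
        · nlinarith [hτ.2]
        · nlinarith [hτ.1]
      have hτs : s < τ := by
        refine lt_of_le_of_ne hτ.1 fun h => ?_
        rw [← h, sub_self, mul_zero, add_zero] at hτρ
        linarith
      have h5 : (r + q * (τ - s) - r) / (τ - s) = q := by
        rw [add_sub_cancel_left, mul_div_cancel_right₀ _ (by linarith)]
      have h6 := value_le hC hu₀ (h.step i hτs hr hz)
      have h7 := hbd τ _ (by linarith) (by linarith [hτ.2]) (smul_mem_junction i hz) hτρ
      rw [h5] at h6
      rw [← hq]
      rcases hτ.2.eq_or_lt with h8 | h8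
      · rw [h8, ← hq'] at h7 h6
        linarith
      · have h9 := hseg i τ s' _ r' (by linarith) h8 h1 hz hr' hτρ.le h2
        have h10 : (r' - (r + q * (τ - s))) / (s' - τ) = q := by
          rw [div_eq_iff (by linarith), hq']
          ring
        rw [h10] at h9
        linarith
  exact le_value ht hx fun c hc => key t x c hc le_rfl (by simpa using hρ0)

/-- On the boundary of the backward neighbourhood of radius `ρ` the gap is `ε * ρ`, and it would
persist at `(t, x)`, where there is equality. The set `A` allows the cost condition to be checked
only on segments with both ends near the point. -/
theorem false_of_strict_support {ψ : ℝ × Plane → ℝ} {t ε : ℝ} {x : Plane} (ht : t ∈ Ioo 0 T)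
    (hx : x ∈ junction e) (hε : 0 < ε) (hψ : ψ (t, x) = value e L u₀ (t, x))
    {A : Set (ℝ × Plane)} (hA : ∀ᶠ Q in 𝓝[openCyl e T] (t, x), Q ∈ A)
    (hseg : ∀ i s s' r r', s < s' → s' ≤ t → 0 ≤ r → 0 ≤ r' →
      (s, r • e i) ∈ A → (s', r' • e i) ∈ A →
        ψ (s', r' • e i) ≤ ψ (s, r • e i) + (s' - s) * L i ((r' - r) / (s' - s)))
    (hsup : ∀ᶠ Q in 𝓝[openCyl e T] (t, x), Q.1 ≤ t →
      ψ Q + ε * (t - Q.1 + ‖Q.2 - x‖) ≤ value e L u₀ Q) : False := by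
  obtain ⟨δ, hδ, h⟩ := Metric.mem_nhdsWithin_iff.1 (hA.and hsup)
  obtain ⟨ρ, hρ, hρδ, hρt⟩ : ∃ ρ > 0, ρ < δ ∧ ρ < t :=
    ⟨min δ t / 2, by have := lt_min hδ ht.1; positivity,
      by have := min_le_left δ t; have := lt_min hδ ht.1; linarith,
      by have := min_le_right δ t; have := lt_min hδ ht.1; linarith⟩
  have hin : ∀ s y, s ≤ t → y ∈ junction e → t - s + ‖y - x‖ ≤ ρ →
      (s, y) ∈ A ∧ (s ≤ t → ψ (s, y) + ε * (t - s + ‖y - x‖) ≤ value e L u₀ (s, y)) := by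
    intro s y hs hy hle
    have h0 := norm_nonneg (y - x)
    refine h ⟨?_, ⟨by linarith, by linarith [ht.2]⟩, hy⟩
    rw [Metric.mem_ball, Prod.dist_eq, max_lt_iff, Real.dist_eq, dist_eq_norm, abs_sub_comm,
      abs_of_nonneg (by linarith)]
    exact ⟨by linarith, by linarith⟩
  have := add_le_value_of_boundary (ψ := ψ) (δ := ε * ρ) hC hu₀ ht.1.le hx hρ.le hρt
    (fun i s s' r r' hs hss hs' hr hr' h1 h2 => hseg i s s' r r' hss hs' hr hr'
      (hin s _ (by linarith) (smul_mem_junction i hr) h1).1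
      (hin s' _ hs' (smul_mem_junction i hr') h2).1)
    (fun s y hs hs' hy heq => by
      have := (hin s y hs' hy heq.le).2 hs'
      rwa [heq] at this)
  have : 0 < ε * ρ := by positivity
  linarith

variable (hL : ∀ i, IsLagrangian (L i))

include he he_inj hL

theorem value_supersolution_branch {φ : ℝ × Plane → ℝ} (hφ : IsTest e T φ) {t r : ℝ}
    (ht : t ∈ Ioo 0 T) {i : Fin N} (hr : 0 < r)
    (h : TouchesFromBelow e T φ (value e L u₀) (t, r • e i)) :
    0 ≤ timeDeriv φ t (r • e i) + ham (L i) (branchDeriv e φ i t r) := by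
  by_contra! hneg
  obtain ⟨a, ha⟩ : ∃ a, a = timeDeriv φ t (r • e i) := ⟨_, rfl⟩
  obtain ⟨p, hp⟩ : ∃ p, p = branchDeriv e φ i t r := ⟨_, rfl⟩
  rw [← ha, ← hp] at hneg
  obtain ⟨ε, hε, hε1, hε2⟩ : ∃ ε > 0, a + 2 * ε + ham (L i) (p - 2 * ε) < 0 ∧
      a + 2 * ε + ham (L i) (p + 2 * ε) < 0 := by
    have hc := (hL i).continuous_ham
    have h1 : Continuous fun ε => a + 2 * ε + ham (L i) (p - 2 * ε) := by fun_prop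
    have h2 : Continuous fun ε => a + 2 * ε + ham (L i) (p + 2 * ε) := by fun_prop
    have h3 := (h1.tendsto 0).mono_left (nhdsWithin_le_nhds (s := Ioi 0))
    have h4 := (h2.tendsto 0).mono_left (nhdsWithin_le_nhds (s := Ioi 0))
    simp only [mul_zero, add_zero, sub_zero] at h3 h4
    obtain ⟨ε, h5, h6, h7⟩ := ((h3.eventually_lt_const hneg).and
      ((h4.eventually_lt_const hneg).and self_mem_nhdsWithin)).exists
    exact ⟨ε, h7, h5, h6⟩
  -- The expansion of `φ` has error `ε`, so corrections of `2 * ε` leave the margin `ε`. As `ψ` is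
  -- concave in the position, its growth along a segment is controlled by its slope at the starting
  -- point, `p - 2 * ε` or `p + 2 * ε`.
  refine false_of_strict_support hC hu₀ (ε := ε) (t := t) (x := r • e i) ht
    (smul_mem_junction i hr.le) hε
    (ψ := fun Q => value e L u₀ (t, r • e i) + (a + 2 * ε) * (Q.1 - t) + p * (‖Q.2‖ - r) -
      2 * ε * |‖Q.2‖ - r|) (A := {Q | Q.2 ∈ branch e i ∧ Q.2 ≠ 0}) ?_ ?_ ?_ ?_
  · simp [norm_smul_unit he i hr.le]
  · refine eventually_nhdsWithin_prod_junction he fun j hj => ?_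
    obtain rfl := eq_of_smul_mem_branch he he_inj hr hj
    rw [norm_smul_unit he i hr.le]
    have : ∀ᶠ z : ℝ × ℝ in 𝓝 (t, r), 0 < z.2 :=
      continuous_snd.continuousAt.eventually_const_lt hr
    filter_upwards [nhdsWithin_le_nhds this] with z hz
    refine ⟨smul_mem_branch _ hz.le, ?_⟩
    rw [← norm_ne_zero_iff, norm_smul_unit he i hz.le]
    exact hz.ne'
  · intro j s s' ρ ρ' hss hs' hρ hρ' hA hA'
    have hρ0 : 0 < ρ := lt_of_le_of_ne hρ fun h0 => hA.2 (by simp [← h0])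
    obtain rfl := eq_of_smul_mem_branch he he_inj hρ0 hA.1
    have hd : 0 < s' - s := by linarith
    obtain ⟨q, hq⟩ : ∃ q, q = (ρ' - ρ) / (s' - s) := ⟨_, rfl⟩
    have hq' : ρ' = ρ + q * (s' - s) := by rw [hq, div_mul_cancel₀ _ hd.ne']; ring
    rw [← hq]
    simp only [norm_smul_unit he j hρ, norm_smul_unit he j hρ']
    have h1 := mul_le_mul_of_nonneg_left ((hL j).le_ham (p - 2 * ε) q) hd.le
    have h2 := mul_le_mul_of_nonneg_left ((hL j).le_ham (p + 2 * ε) q) hd.le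
    have h3 := mul_lt_mul_of_pos_left hε1 hd
    have h4 := mul_lt_mul_of_pos_left hε2 hd
    have h5 := mul_le_mul_of_nonneg_left (le_abs_self (ρ' - r)) (by linarith : 0 ≤ 2 * ε)
    have h6 := mul_le_mul_of_nonneg_left (neg_le_abs (ρ' - r)) (by linarith : 0 ≤ 2 * ε)
    rw [hq'] at h5 h6 ⊢
    rcases abs_cases (ρ - r) with ⟨h7, -⟩ | ⟨h7, -⟩
    · rw [h7]
      linarith
    · rw [h7]
      linarith
  · refine eventually_nhdsWithin_prod_junction he fun j hj => ?_
    obtain rfl := eq_of_smul_mem_branch he he_inj hr hj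
    rw [norm_smul_unit he i hr.le]
    filter_upwards [hφ.expansion ht hr.le i hε, (tendsto_branch_coord i t r).eventually h.1,
      self_mem_nhdsWithin] with z hz hz' hmem hzt
    rw [norm_smul_unit he i hmem.2, ← sub_smul, norm_smul, he, mul_one, Real.norm_eq_abs]
    rw [← ha, ← hp, abs_of_nonpos (by linarith : z.1 - t ≤ 0)] at hz
    have h2 := h.2
    have := (abs_le.1 hz).1
    linarith

theorem value_supersolution_junction (hN : 1 ≤ N) {φ : ℝ × Plane → ℝ} (hφ : IsTest e T φ) {t : ℝ}
    (ht : t ∈ Ioo 0 T) (h : TouchesFromBelow e T φ (value e L u₀) (t, 0)) :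
    0 ≤ timeDeriv φ t 0 + ⨆ i, hamNeg (L i) (branchDeriv e φ i t 0) := by
  by_contra! hneg
  have : Nonempty (Fin N) := ⟨⟨0, hN⟩⟩
  obtain ⟨a, ha⟩ : ∃ a, a = timeDeriv φ t 0 := ⟨_, rfl⟩
  -- Lowering the slopes keeps the support function below `φ`, since `r ≥ 0`, and turns a bound on
  -- `H⁻` into one on `H`, valid for speeds of both signs.
  choose p hp hpH using fun i => (hL i).exists_le_ham_le_hamNeg (branchDeriv e φ i t 0)
  rw [← ha] at hneg
  have hneg' : ∀ i, a + ham (L i) (p i) < 0 := fun i => by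
    have : hamNeg (L i) (branchDeriv e φ i t 0) ≤ ⨆ i, hamNeg (L i) (branchDeriv e φ i t 0) :=
      le_ciSup (f := fun i => hamNeg (L i) (branchDeriv e φ i t 0)) (finite_range _).bddAbove i
    linarith [hpH i]
  obtain ⟨ε, hε, hεi⟩ : ∃ ε > 0, ∀ i, a + 2 * ε + ham (L i) (p i - 2 * ε) < 0 := by
    have h3 : ∀ i, ∀ᶠ ε in 𝓝[>] 0, a + 2 * ε + ham (L i) (p i - 2 * ε) < 0 := fun i => by
      have hc := (hL i).continuous_ham
      have h1 : Continuous fun ε => a + 2 * ε + ham (L i) (p i - 2 * ε) := by fun_prop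
      have h3 := (h1.tendsto 0).mono_left (nhdsWithin_le_nhds (s := Ioi 0))
      simp only [mul_zero, add_zero, sub_zero] at h3
      exact h3.eventually_lt_const (hneg' i)
    obtain ⟨ε, h5, h7⟩ := ((eventually_all.2 h3).and self_mem_nhdsWithin).exists
    exact ⟨ε, h7, h5⟩
  have hf : ∀ (i j : Fin N) (s : ℝ),
      value e L u₀ (t, 0) + (a + 2 * ε) * ((s, (0 : ℝ)).1 - t) + (p i - 2 * ε) * (s, (0 : ℝ)).2 =
      value e L u₀ (t, 0) + (a + 2 * ε) * ((s, (0 : ℝ)).1 - t) + (p j - 2 * ε) * (s, (0 : ℝ)).2 := by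
    intro i j s
    simp
  have hg := fun i s {r} => glue_apply (e := e) (f := fun i z =>
    value e L u₀ (t, 0) + (a + 2 * ε) * (z.1 - t) + (p i - 2 * ε) * z.2) he he_inj hf i s (r := r)
  refine false_of_strict_support hC hu₀ (ε := ε) (t := t) (x := 0) ht
    (by simpa using smul_mem_junction (e := e) ⟨0, hN⟩ le_rfl) hε
    (ψ := glue e fun i z =>
      value e L u₀ (t, 0) + (a + 2 * ε) * (z.1 - t) + (p i - 2 * ε) * z.2) (A := univ) ?_
      (by simp) ?_ ?_
  · have := hg ⟨0, hN⟩ t le_rfl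
    rw [zero_smul] at this
    rw [this]
    simp
  · intro j s s' ρ ρ' hss hs' hρ hρ' _ _
    have hd : 0 < s' - s := by linarith
    obtain ⟨q, hq⟩ : ∃ q, q = (ρ' - ρ) / (s' - s) := ⟨_, rfl⟩
    have hq' : ρ' = ρ + q * (s' - s) := by rw [hq, div_mul_cancel₀ _ hd.ne']; ring
    rw [← hq, hg j s hρ, hg j s' hρ']
    have h1 := mul_le_mul_of_nonneg_left ((hL j).le_ham (p j - 2 * ε) q) hd.le
    have h3 := mul_lt_mul_of_pos_left (hεi j) hd
    simp only
    rw [hq']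
    linarith
  · refine eventually_nhdsWithin_prod_junction he fun j _ => ?_
    rw [norm_zero]
    have hexp := hφ.expansion ht le_rfl j hε
    have hev := (tendsto_branch_coord (e := e) (T := T) j t 0)
    rw [zero_smul] at hexp hev
    filter_upwards [hexp, hev.eventually h.1, self_mem_nhdsWithin] with z hz hz' hmem hzt
    have hz2 : 0 ≤ z.2 := hmem.2
    rw [hg j z.1 hz2, sub_zero, norm_smul_unit he j hz2]
    rw [← ha, abs_of_nonpos (by linarith : z.1 - t ≤ 0), sub_zero, abs_of_nonneg hz2] at hz
    have h2 := h.2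
    have h3 := (abs_le.1 hz).1
    have h4 := mul_le_mul_of_nonneg_right (hp j) hz2
    simp only
    linarith

theorem isSupersolution_value (hN : 1 ≤ N)
    (hlsc : LowerSemicontinuousOn (value e L u₀) (cyl e T)) :
    IsSupersolution e L T (value e L u₀) :=
  ⟨hlsc, fun _ hφ _ ht _ _ hr h => value_supersolution_branch he he_inj hC hu₀ hL hφ ht hr h,
    fun _ hφ _ ht h => value_supersolution_junction he he_inj hC hu₀ hL hN hφ ht h⟩

end ValueSuper

/-! ### Backward barriers and super-solutions -/

section Perspective

/-- The backward barrier built from the perspective of a function `G` of the speed. -/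
noncomputable def backwardBarrier (G : ℝ → ℝ) (b t₀ t₁ η M : ℝ) (z : ℝ × ℝ) : ℝ :=
  -((t₁ - z.1) * G ((b - z.2) / (t₁ - z.1)) + η * z.1 + M * max (z.1 - t₀) 0 ^ 2)

variable {G G' : ℝ → ℝ} (hG : ∀ w, HasDerivAt G (G' w) w) {b t₀ t₁ η M : ℝ}

include hG

theorem contDiffOn_backwardBarrier (hG' : Continuous G') :
    ContDiffOn ℝ 1 (backwardBarrier G b t₀ t₁ η M) (Iio t₁ ×ˢ univ) := by
  have hGc : ContDiff ℝ 1 G := by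
    rw [contDiff_one_iff_deriv]
    refine ⟨fun w => (hG w).differentiableAt, ?_⟩
    rwa [funext fun w => (hG w).deriv]
  have hmaxc : ContDiff ℝ 1 fun z : ℝ × ℝ => max (z.1 - t₀) 0 ^ 2 :=
    contDiff_max_sq.comp (contDiff_fst.sub contDiff_const)
  have h1 : ContDiffOn ℝ 1 (fun z : ℝ × ℝ => (b - z.2) / (t₁ - z.1)) (Iio t₁ ×ˢ univ) :=
    (contDiff_const.sub contDiff_snd).contDiffOn.div (contDiff_const.sub contDiff_fst).contDiffOn
      fun z hz => (sub_pos.2 hz.1).ne'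
  have h2 := hGc.comp_contDiffOn h1
  have h3 : ContDiff ℝ 1 fun z : ℝ × ℝ => t₁ - z.1 := by fun_prop
  have h4 : ContDiff ℝ 1 fun z : ℝ × ℝ => η * z.1 := by fun_prop
  exact (((h3.contDiffOn.mul h2).add h4.contDiffOn).add
    (contDiff_const.mul hmaxc).contDiffOn).neg

/-- With the space derivative `G' w`, the equation evaluates to `G w - w * G' w + H(G' w)` minus `η`
and the penalty term: the barrier is a strict sub-solution as soon as the first expression is
nonpositive. -/
theorem hasDerivAt_backwardBarrier_time {τ ρ w : ℝ} (hτ : τ < t₁) (hw : w = (b - ρ) / (t₁ - τ)) :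
    HasDerivAt (fun τ => backwardBarrier G b t₀ t₁ η M (τ, ρ))
      (G w - w * G' w - η - 2 * M * max (τ - t₀) 0) τ := by
  have hne : t₁ - τ ≠ 0 := (sub_pos.2 hτ).ne'
  have h1 : HasDerivAt (fun τ : ℝ => max (τ - t₀) 0 ^ 2) (2 * max (τ - t₀) 0) τ := by
    simpa [Function.comp_def] using
      (hasDerivAt_max_sq (τ - t₀)).comp τ ((hasDerivAt_id τ).sub_const t₀)
  have h2 : HasDerivAt (fun τ : ℝ => t₁ - τ) (-1) τ := (hasDerivAt_id τ).const_sub t₁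
  have h3 : HasDerivAt (fun τ : ℝ => (b - ρ) / (t₁ - τ)) (w / (t₁ - τ)) τ := by
    refine ((hasDerivAt_const τ (b - ρ)).div h2 hne).congr_deriv ?_
    rw [hw]
    field_simp
    ring
  have h4 : HasDerivAt (fun τ => G ((b - ρ) / (t₁ - τ))) (G' w * (w / (t₁ - τ))) τ := by
    have := hG w
    rw [hw] at this ⊢
    exact this.comp τ (hw ▸ h3)
  refine (((h2.mul h4).add ((hasDerivAt_id τ).const_mul η)).add (h1.const_mul M)).neg.congr_deriv ?_
  rw [← hw]
  field_simp
  ring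

theorem hasDerivAt_backwardBarrier_space {τ ρ w : ℝ} (hτ : τ < t₁)
    (hw : w = (b - ρ) / (t₁ - τ)) :
    HasDerivAt (fun ρ => backwardBarrier G b t₀ t₁ η M (τ, ρ)) (G' w) ρ := by
  have hne : t₁ - τ ≠ 0 := (sub_pos.2 hτ).ne'
  have h3 : HasDerivAt (fun ρ : ℝ => (b - ρ) / (t₁ - τ)) (-1 / (t₁ - τ)) ρ :=
    ((hasDerivAt_id ρ).const_sub b).div_const _
  have h4 : HasDerivAt (fun ρ => G ((b - ρ) / (t₁ - τ))) (G' w * (-1 / (t₁ - τ))) ρ := by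
    have := hG w
    rw [hw] at this ⊢
    exact this.comp ρ h3
  refine ((((h4.const_mul (t₁ - τ)).add_const (η * τ)).add_const
    (M * max (τ - t₀) 0 ^ 2)).neg).congr_deriv ?_
  field_simp

end Perspective

section Supersolution

variable {e : Fin N → Plane} (he : ∀ i, ‖e i‖ = 1) (he_inj : Function.Injective e)
  {L : Fin N → ℝ → ℝ} (hL : ∀ i, IsLagrangian (L i)) {T : ℝ} {v : ℝ × Plane → ℝ}

/-- A minimum point over finitely many compact pieces of branches. -/
theorem exists_min_of_compact {J : Set (Fin N)} (hJ : J.Nonempty)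
    (hv : LowerSemicontinuousOn v (cyl e T)) {S : Set (ℝ × ℝ)} (hne : S.Nonempty)
    (hS : IsCompact S) (hSs : S ⊆ Ico 0 T ×ˢ Ici 0) {f : Fin N → ℝ × ℝ → ℝ}
    (hf : ∀ j, ContinuousOn (f j) S) :
    ∃ j ∈ J, ∃ z ∈ S, ∀ i ∈ J, ∀ w ∈ S,
      v (z.1, z.2 • e j) - f j z ≤ v (w.1, w.2 • e i) - f i w := by
  have h : ∀ j : Fin N, ∃ z ∈ S, ∀ w ∈ S,
      v (z.1, z.2 • e j) - f j z ≤ v (w.1, w.2 • e j) - f j w := fun j => by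
    have h1 := ((lowerSemicontinuousOn_branch hv j).mono hSs).add
      (hf j).neg.lowerSemicontinuousOn
    obtain ⟨z, hzS, hz⟩ := h1.exists_isMinOn hne hS
    exact ⟨z, hzS, fun w hw => by simpa [sub_eq_add_neg] using hz hw⟩
  choose z hzS hz using h
  obtain ⟨j, hjJ, hj⟩ :=
    Set.exists_min_image J (fun j => v ((z j).1, (z j).2 • e j) - f j (z j)) J.toFinite hJ
  exact ⟨j, hjJ, z j, hzS j, fun i hi w hw => (hj i hi).trans (hz i w hw)⟩

include he he_inj hL

set_option maxHeartbeats 600000 in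
/-- Comparison of a super-solution with a backward barrier that is itself a classical
sub-solution, either on a single branch with data at the junction point or on the whole
junction. -/
theorem IsSupersolution.le_of_barrier (hN : 1 ≤ N) (hv : IsSupersolution e L T v) {k₀ C₀ : ℝ}
    (hk₀ : 0 ≤ k₀) (hbd : ∀ j s r, s ∈ Ico 0 T → 0 ≤ r → -(k₀ * r) - C₀ ≤ v (s, r • e j))
    {J : Set (Fin N)} {i : Fin N} (hi : i ∈ J) {G G' : Fin N → ℝ → ℝ}
    (hG : ∀ j w, HasDerivAt (G j) (G' j w) w) (hG' : ∀ j, Continuous (G' j))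
    (hHJ : ∀ j ∈ J, ∀ w, G j w - w * G' j w + ham (L j) (G' j w) ≤ 0)
    {b t₀ t₁ m : ℝ} (hb : 0 ≤ b)
    (hco : ∀ j, ∃ C₁, ∀ w, (b = 0 → w ≤ 0) → (k₀ + 1) * |w| ≤ G j w + C₁)
    (ht₀ : 0 < t₀) (ht₁ : t₀ < t₁) (ht₁T : t₁ < T)
    (hinit : ∀ j ∈ J, ∀ r, 0 ≤ r → m ≤ v (0, r • e j) + t₁ * G j ((b - r) / t₁))
    (hjun : (∀ j ∈ J, ∀ s ∈ Ioo 0 t₁, m ≤ v (s, 0) + (t₁ - s) * G j (b / (t₁ - s))) ∨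
      (J = univ ∧ b = 0 ∧ ∀ j j', G j 0 = G j' 0)) :
    m ≤ v (t₀, b • e i) + (t₁ - t₀) * G i 0 := by
  by_contra! hcon
  obtain ⟨β, hβ⟩ : ∃ β, β = m - (v (t₀, b • e i) + (t₁ - t₀) * G i 0) := ⟨_, rfl⟩
  have hβ0 : 0 < β := by linarith
  -- The strictness term uses up only half of the defect `β`, so the minimum stays below `m`.
  obtain ⟨η, hη0, hη⟩ : ∃ η > 0, η * t₀ = β / 2 := ⟨β / 2 / t₀, by positivity, by field_simp⟩
  obtain ⟨t₂, ht₂, ht₂'⟩ : ∃ t₂, t₀ < t₂ ∧ t₂ < t₁ := exists_between ht₁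
  choose C₁ hC₁ using hco
  obtain ⟨C₂, hC₂0, hC₂⟩ : ∃ C₂, 0 ≤ C₂ ∧ ∀ j, C₁ j ≤ C₂ := by
    obtain ⟨B, hB⟩ := (finite_range C₁).bddAbove
    exact ⟨max B 0, le_max_right _ _, fun j => (hB ⟨j, rfl⟩).trans (le_max_left _ _)⟩
  obtain ⟨E, hE⟩ : ∃ E, E = C₀ + (k₀ + 1) * b + C₂ * t₁ := ⟨_, rfl⟩
  have hlow : ∀ j s r, 0 ≤ s → s < t₁ → 0 ≤ r →
      r - E ≤ v (s, r • e j) + (t₁ - s) * G j ((b - r) / (t₁ - s)) := by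
    intro j s r hs hs' hr
    have hd : 0 < t₁ - s := by linarith
    have h1 := hbd j s r ⟨hs, hs'.trans ht₁T⟩ hr
    -- For `b = 0` only nonpositive mean speeds occur, and `junctionCost` is superlinear only there.
    -- The rate `k₀ + 1` beats the decay of `v` by one unit, which gives coercivity in `r`.
    have h2 := hC₁ j ((b - r) / (t₁ - s)) fun h =>
      div_nonpos_of_nonpos_of_nonneg (by linarith) hd.le
    rw [abs_div, abs_of_pos hd] at h2
    have h3 := mul_le_mul_of_nonneg_left h2 hd.le
    have h4 : (t₁ - s) * ((k₀ + 1) * (|b - r| / (t₁ - s))) = (k₀ + 1) * |b - r| := by field_simp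
    have h5 : (k₀ + 1) * (r - b) ≤ (k₀ + 1) * |b - r| := by
      gcongr
      linarith [neg_abs_le (b - r)]
    have h6 : (t₁ - s) * C₁ j ≤ t₁ * C₂ := by
      have := mul_le_mul_of_nonneg_left (hC₂ j) hd.le
      nlinarith
    linarith
  obtain ⟨R, hRb, hRE⟩ : ∃ R, b < R ∧ m + E < R :=
    ⟨max b (m + E) + 1, by linarith [le_max_left b (m + E)], by linarith [le_max_right b (m + E)]⟩
  obtain ⟨M, hM0, hM⟩ : ∃ M, 0 ≤ M ∧ m + E ≤ M * (t₂ - t₀) ^ 2 := by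
    have h : 0 < (t₂ - t₀) ^ 2 := by have := sub_pos.2 ht₂; positivity
    refine ⟨|m + E| / (t₂ - t₀) ^ 2, by positivity, ?_⟩
    rw [div_mul_cancel₀ _ h.ne']
    exact le_abs_self _
  have hSs : Icc 0 t₂ ×ˢ Icc 0 R ⊆ Ico 0 T ×ˢ Ici 0 := fun z hz =>
    ⟨⟨hz.1.1, hz.1.2.trans_lt (ht₂'.trans ht₁T)⟩, hz.2.1⟩
  have hfc := fun j => contDiffOn_backwardBarrier (b := b) (t₀ := t₀) (t₁ := t₁) (η := η) (M := M)
    (hG j) (hG' j)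
  obtain ⟨j, hjJ, ⟨τ, ρ⟩, ⟨⟨hτ0, hτt⟩, hρ0, hρR⟩, hmin⟩ :=
    exists_min_of_compact (S := Icc 0 t₂ ×ˢ Icc 0 R) ⟨i, hi⟩ hv.lsc
      ⟨(0, 0), left_mem_Icc.2 (by linarith), left_mem_Icc.2 (by linarith)⟩
      (isCompact_Icc.prod isCompact_Icc) hSs
      fun j => (hfc j).continuousOn.mono fun z hz => ⟨hz.1.2.trans_lt ht₂', mem_univ _⟩
  simp only at hτ0 hτt hρ0 hρR hmin
  have hτ1 : τ < t₁ := by linarith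
  obtain ⟨V, hV⟩ : ∃ V, V = v (τ, ρ • e j) - backwardBarrier (G j) b t₀ t₁ η M (τ, ρ) := ⟨_, rfl⟩
  rw [← hV] at hmin
  have hVe : V = v (τ, ρ • e j) + (t₁ - τ) * G j ((b - ρ) / (t₁ - τ)) + η * τ +
      M * max (τ - t₀) 0 ^ 2 := by rw [hV, backwardBarrier]; ring
  have hVm : V < m := by
    have h1 := hmin i hi (t₀, b) ⟨⟨ht₀.le, ht₂.le⟩, hb, hRb.le⟩
    simp only [backwardBarrier, sub_self, zero_div, max_self] at h1
    linarith
  have hMmax : 0 ≤ M * max (τ - t₀) 0 ^ 2 := by positivity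
  have hMmax' : 0 ≤ 2 * M * max (τ - t₀) 0 := by positivity
  have hητ : 0 ≤ η * τ := by positivity
  have hl := hlow j τ ρ hτ0 hτ1 hρ0
  have h_bot : 0 < τ := by
    refine lt_of_le_of_ne hτ0 fun h => ?_
    subst h
    have := hinit j hjJ ρ hρ0
    rw [sub_zero] at hVe
    linarith
  have h_top : τ < t₂ := by
    refine lt_of_le_of_ne hτt fun h => ?_
    rw [h, max_eq_left (by linarith), ← h] at hVe
    rw [h] at hητ hl hVe
    linarith
  have h_side : ρ < R := by
    refine lt_of_le_of_ne hρR fun h => ?_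
    linarith
  have hτT : τ ∈ Ioo 0 T := ⟨h_bot, by linarith⟩
  have heq : v (τ, ρ • e j) = V + backwardBarrier (G j) b t₀ t₁ η M (τ, ρ) := by rw [hV]; ring
  rcases hρ0.eq_or_lt with h0 | hρpos
  · subst h0
    -- Either the data at the origin exclude a minimum there, or the barriers of all branches agree
    -- at the origin and the junction inequality applies to them.
    rcases hjun with hjun | ⟨rfl, rfl, hG0⟩
    · have := hjun j hjJ τ ⟨h_bot, hτ1⟩
      rw [zero_smul, sub_zero] at hVe
      linarith
    · have hf0 : ∀ i j s, backwardBarrier (G i) 0 t₀ t₁ η M (s, 0) =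
          backwardBarrier (G j) 0 t₀ t₁ η M (s, 0) := by
        intro i j s
        simp only [backwardBarrier, sub_self, zero_div, hG0 i j]
      have hw : (0 : ℝ) = (0 - 0) / (t₁ - τ) := by simp
      have hex := hv.junction_ineq he he_inj hN
        (f := fun j z => V + backwardBarrier (G j) 0 t₀ t₁ η M z) (t := τ) (t₁ := t₁)
        (a := G j 0 - η - 2 * M * max (τ - t₀) 0) (p := fun j => G' j 0) hτT hτ1
        (fun a b s => by simp only [hf0 a b]) (fun a => contDiffOn_const.add (hfc a))
        (fun a => (((hasDerivAt_backwardBarrier_time (hG a) hτ1 hw).congr_deriv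
          (by rw [hG0 a j]; ring)).const_add V))
        (fun a => ((hasDerivAt_backwardBarrier_space (hG a) hτ1 hw).const_add V))
        (fun a => ?_) (fun a => ?_)
      · obtain ⟨a, ha⟩ := hex
        have h1 := hHJ a (mem_univ a) 0
        rw [hG0 a j] at h1
        have h2 := (hL a).hamNeg_le_ham (G' a 0)
        linarith
      · have : Icc 0 t₂ ×ˢ Iio R ∈ 𝓝 (τ, (0 : ℝ)) :=
          prod_mem_nhds (Icc_mem_nhds h_bot h_top) (Iio_mem_nhds (by linarith))
        filter_upwards [this] with z hz hz0
        linarith [hmin a (mem_univ a) z ⟨hz.1, hz0, hz.2.le⟩]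
      · rw [hf0 a j, ← heq, zero_smul]
  · have hnear : ∀ᶠ z in 𝓝 (τ, ρ),
        V + backwardBarrier (G j) b t₀ t₁ η M z ≤ v (z.1, z.2 • e j) := by
      have : Icc 0 t₂ ×ˢ Icc 0 R ∈ 𝓝 (τ, ρ) :=
        prod_mem_nhds (Icc_mem_nhds h_bot h_top) (Icc_mem_nhds hρpos h_side)
      filter_upwards [this] with z hz
      linarith [hmin j hjJ z hz]
    have h1 := hv.branch_ineq he he_inj (f := fun z => V + backwardBarrier (G j) b t₀ t₁ η M z)
      (t₁ := t₁) hτT hτ1 hρpos (contDiffOn_const.add (hfc j))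
      ((hasDerivAt_backwardBarrier_time (hG j) hτ1 rfl).const_add V)
      ((hasDerivAt_backwardBarrier_space (hG j) hτ1 rfl).const_add V) hnear heq
    have h2 := hHJ j hjJ ((b - ρ) / (t₁ - τ))
    linarith

end Supersolution

/-! ### The cost of reaching the junction point and waiting there -/

section JunctionCost

/-- The optimal cost per unit of time for reaching the junction point with mean speed `w ≤ 0`,
where `w₀ ≤ 0` is the optimal speed and `A` is the cost of waiting at the junction point. -/
noncomputable def junctionCost (L : ℝ → ℝ) (A w₀ w : ℝ) : ℝ :=
  A + ∫ y in (0 : ℝ)..w, deriv L (min y w₀)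

variable {L : ℝ → ℝ} (hL : IsLagrangian L) {A w₀ : ℝ}

theorem junctionCost_zero : junctionCost L A w₀ 0 = A := by simp [junctionCost]

include hL

theorem continuous_deriv_min : Continuous fun w => deriv L (min w w₀) :=
  hL.continuous_deriv.comp (continuous_id.min continuous_const)

theorem hasDerivAt_junctionCost (w : ℝ) :
    HasDerivAt (junctionCost L A w₀) (deriv L (min w w₀)) w := by
  have hc := continuous_deriv_min hL (w₀ := w₀)
  exact (intervalIntegral.integral_hasDerivAt_right (hc.intervalIntegrable _ _)
    hc.stronglyMeasurable.stronglyMeasurableAtFilter hc.continuousAt).const_add A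

variable (hw₀ : w₀ ≤ 0)

include hw₀

omit hL in
theorem junctionCost_of_ge {w : ℝ} (hw : w₀ ≤ w) :
    junctionCost L A w₀ w = A + deriv L w₀ * w := by
  have : ∫ y in (0 : ℝ)..w, deriv L (min y w₀) = ∫ _ in (0 : ℝ)..w, deriv L w₀ := by
    refine intervalIntegral.integral_congr fun y hy => ?_
    have h : w₀ ≤ y := (le_min hw₀ hw).trans hy.1
    simp only [min_eq_right h]
  rw [junctionCost, this, intervalIntegral.integral_const, sub_zero, smul_eq_mul, mul_comm]

variable (hA : L w₀ - w₀ * deriv L w₀ = A)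

include hA

/-- By `hA` the tangent to `L` at `w₀` takes the value `A` at `0`. The cost is therefore `L` up to
`w₀`, continued by this tangent, with a `C¹` junction. -/
theorem junctionCost_of_le {w : ℝ} (hw : w ≤ w₀) : junctionCost L A w₀ w = L w := by
  have hc := continuous_deriv_min hL (w₀ := w₀)
  have h1 : ∫ y in w₀..w, deriv L (min y w₀) = L w - L w₀ := by
    rw [← intervalIntegral.integral_deriv_eq_sub (fun x _ => (hL.hasDerivAt x).differentiableAt)
      (hL.continuous_deriv.intervalIntegrable _ _)]
    refine intervalIntegral.integral_congr fun y hy => ?_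
    rw [uIcc_of_ge hw] at hy
    simp only [min_eq_left hy.2]
  have h2 := junctionCost_of_ge (L := L) (A := A) hw₀ (le_refl w₀)
  rw [junctionCost] at h2 ⊢
  rw [← intervalIntegral.integral_add_adjacent_intervals (hc.intervalIntegrable 0 w₀)
    (hc.intervalIntegrable w₀ w), h1]
  linarith

theorem junctionCost_hamilton_jacobi (w : ℝ) :
    junctionCost L A w₀ w - w * deriv L (min w w₀) + ham L (deriv L (min w w₀)) ≤ 0 := by
  rcases le_total w w₀ with h | h
  · rw [junctionCost_of_le hL hw₀ hA h, min_eq_left h]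
    linarith [hL.ham_deriv_le w]
  · rw [junctionCost_of_ge hw₀ h, min_eq_right h]
    linarith [hL.ham_deriv_le w₀]

theorem junctionCost_superlinear {k : ℝ} (hk : 0 ≤ k) :
    ∃ C, ∀ w ≤ 0, k * |w| ≤ junctionCost L A w₀ w + C := by
  obtain ⟨C, hC0, hC⟩ := hL.superlinear k
  refine ⟨C + k * |w₀| + |A| + |deriv L w₀| * |w₀|, fun w hw => ?_⟩
  have h1 : 0 ≤ k * |w₀| := by positivity
  have h2 : 0 ≤ |deriv L w₀| * |w₀| := by positivity
  have h3 := abs_nonneg A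
  rcases le_total w w₀ with h | h
  · rw [junctionCost_of_le hL hw₀ hA h]
    linarith [hC w]
  · rw [junctionCost_of_ge hw₀ h]
    have h4 : |w| ≤ |w₀| := by rw [abs_of_nonpos hw, abs_of_nonpos hw₀]; linarith
    have h5 : k * |w| ≤ k * |w₀| := by gcongr
    have h6 : |deriv L w₀| * |w| ≤ |deriv L w₀| * |w₀| := by gcongr
    have h7 := neg_abs_le (deriv L w₀ * w)
    rw [abs_mul] at h7
    linarith [neg_abs_le A]

end JunctionCost

/-! ### Super-solutions lie above the value function -/

section Comparison

variable {e : Fin N → Plane} (he : ∀ i, ‖e i‖ = 1) (he_inj : Function.Injective e)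
  {L : Fin N → ℝ → ℝ} {T : ℝ} {u₀ : Plane → ℝ} {K C : ℝ}
  (hC : ∀ i q, K * |q| ≤ L i q + C)
  (hu₀ : ∀ i r r', 0 ≤ r → 0 ≤ r' → |u₀ (r • e i) - u₀ (r' • e i)| ≤ K * |r - r'|)

include hC hu₀

/-- If the mean speed is at most `w₀`, go straight to the origin; otherwise run at speed `w₀` and
spend the remaining time waiting on branch `k`. -/
theorem value_junction_le (hL : ∀ i, IsLagrangian (L i)) {A w₀ : ℝ} {i k : Fin N} (hAk : L k 0 = A)
    (hw₀ : w₀ ≤ 0) (hA : L i w₀ - w₀ * deriv (L i) w₀ = A) {t r : ℝ} (ht : 0 < t) (hr : 0 ≤ r) :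
    value e L u₀ (t, 0) ≤ u₀ (r • e i) + t * junctionCost (L i) A w₀ ((0 - r) / t) := by
  have h0 := value_zero hC hu₀ (smul_mem_junction (e := e) i hr)
  rcases le_or_gt ((0 - r) / t) w₀ with h | h
  · rw [junctionCost_of_le (hL i) hw₀ hA h]
    have := value_segment hC hu₀ (i := i) le_rfl ht hr le_rfl
    rwa [zero_smul, sub_zero, h0] at this
  · rw [junctionCost_of_ge hw₀ h.le]
    have h1 : t * (A + deriv (L i) w₀ * ((0 - r) / t)) = t * A - r * deriv (L i) w₀ := by
      field_simp
      ring
    rw [h1]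
    have hwait : ∀ s, 0 ≤ s → s < t →
        value e L u₀ (t, 0) ≤ value e L u₀ (s, 0) + (t - s) * A := by
      intro s hs hst
      have := value_segment hC hu₀ (i := k) hs hst le_rfl le_rfl
      rwa [zero_smul, sub_self, zero_div, hAk] at this
    rcases hr.eq_or_lt with rfl | hr0
    · have := hwait 0 le_rfl ht
      rw [zero_smul] at h0 ⊢
      rw [h0] at this
      linarith
    · rw [lt_div_iff₀ ht] at h
      have hneg : w₀ < 0 := by nlinarith
      obtain ⟨τ, hτ⟩ : ∃ τ, τ = r / -w₀ := ⟨_, rfl⟩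
      have hτ0 : 0 < τ := hτ ▸ div_pos hr0 (by linarith)
      have hτr : τ * w₀ = -r := by
        rw [hτ, div_neg, neg_mul, div_mul_cancel₀ _ hneg.ne]
      have hτt : τ < t := by nlinarith
      have h2 := value_segment hC hu₀ (i := i) le_rfl hτ0 hr le_rfl
      have h3 : (0 - r) / (τ - 0) = w₀ := by
        rw [div_eq_iff (by linarith)]
        linarith
      rw [h3, zero_smul, sub_zero, h0] at h2
      have h4 := hwait τ hτ0.le hτt
      have h5 : τ * L i w₀ = τ * A - r * deriv (L i) w₀ := by
        rw [← hA]
        linear_combination deriv (L i) w₀ * hτr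
      linarith

include he he_inj

variable (hL : ∀ i, IsLagrangian (L i))

include hL

omit he he_inj hL in
-- The barriers are singular at their final time `t₁`, so they compare `v` at `t₀` with `value` at
-- `t₁ > t₀`. The limit `t₁ → t₀` uses that `value` drops by at most `C * (t₁ - t₀)`.
theorem value_le_of_forall_later {t₀ a B : ℝ} {x : Plane} (ht₀ : 0 ≤ t₀) (htT : t₀ < T)
    (hx : x ∈ junction e)
    (h : ∀ t₁ ∈ Ioo t₀ T, value e L u₀ (t₁, x) ≤ a + (t₁ - t₀) * B) : value e L u₀ (t₀, x) ≤ a := by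
  have hlim : Tendsto (fun t₁ => a + (t₁ - t₀) * (B + C)) (𝓝[Ioo t₀ T] t₀) (𝓝 a) := by
    have : Continuous fun t₁ => a + (t₁ - t₀) * (B + C) := by fun_prop
    have h := this.tendsto t₀
    simp only [sub_self, zero_mul, add_zero] at h
    exact h.mono_left nhdsWithin_le_nhds
  have : (𝓝[Ioo t₀ T] t₀).NeBot := left_nhdsWithin_Ioo_neBot htT
  refine ge_of_tendsto hlim (eventually_nhdsWithin_of_forall fun t₁ ht₁ => ?_)
  linarith [h t₁ ht₁, value_sub_le_value hC hu₀ ht₀ ht₁.1.le hx]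

theorem IsSupersolution.value_le_junction (hN : 1 ≤ N) {v : ℝ × Plane → ℝ}
    (hv : IsSupersolution e L T v) {k₀ C₀ : ℝ} (hk₀ : 0 ≤ k₀)
    (hbd : ∀ j s r, s ∈ Ico 0 T → 0 ≤ r → -(k₀ * r) - C₀ ≤ v (s, r • e j))
    (hv0 : ∀ x ∈ junction e, u₀ x ≤ v (0, x)) {t : ℝ} (ht : t ∈ Ioo 0 T) :
    value e L u₀ (t, 0) ≤ v (t, 0) := by
  have : Nonempty (Fin N) := ⟨⟨0, hN⟩⟩
  -- Waiting is done on the cheapest branch `k`. As `L k 0 ≤ L i 0`, each branch has a tangent of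
  -- intercept `L k 0` at some speed `w i ≤ 0`, and all junction costs agree at `0`.
  obtain ⟨k, hk⟩ := Finite.exists_min fun i => L i 0
  choose w hw hA using fun i => (hL i).exists_nonpos_eq (hk i)
  have h0 : (0 : Plane) ∈ junction e := by simpa using smul_mem_junction (e := e) k le_rfl
  refine value_le_of_forall_later hC hu₀ (B := L k 0) ht.1.le ht.2 h0 fun t₁ ht₁ => ?_
  have := hv.le_of_barrier he he_inj hL hN hk₀ hbd (J := univ) (i := k) (mem_univ k)
    (G := fun i => junctionCost (L i) (L k 0) (w i)) (G' := fun i y => deriv (L i) (min y (w i)))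
    (fun j y => hasDerivAt_junctionCost (hL j) y) (fun j => continuous_deriv_min (hL j))
    (fun j _ y => junctionCost_hamilton_jacobi (hL j) (hw j) (hA j) y) (b := 0) (t₀ := t)
    (t₁ := t₁) (m := value e L u₀ (t₁, 0)) le_rfl
    (fun j => by
      obtain ⟨C₁, h⟩ := junctionCost_superlinear (hL j) (hw j) (hA j) (by linarith : 0 ≤ k₀ + 1)
      exact ⟨C₁, fun y hy => h y (hy rfl)⟩) ht.1 ht₁.1 ht₁.2
    (fun j _ r hr => by
      have h1 := value_junction_le hC hu₀ hL (i := j) (k := k) rfl (hw j) (hA j)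
        (ht.1.trans ht₁.1) hr
      linarith [hv0 _ (smul_mem_junction (e := e) j hr)])
    (Or.inr ⟨rfl, rfl, fun i j => by simp only [junctionCost_zero]⟩)
  simpa only [zero_smul, junctionCost_zero] using this

theorem IsSupersolution.value_le (hN : 1 ≤ N) {v : ℝ × Plane → ℝ}
    (hv : IsSupersolution e L T v) {k₀ C₀ : ℝ} (hk₀ : 0 ≤ k₀)
    (hbd : ∀ j s r, s ∈ Ico 0 T → 0 ≤ r → -(k₀ * r) - C₀ ≤ v (s, r • e j))
    (hv0 : ∀ x ∈ junction e, u₀ x ≤ v (0, x)) {t : ℝ} (ht : t ∈ Ico 0 T) {x : Plane}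
    (hx : x ∈ junction e) : value e L u₀ (t, x) ≤ v (t, x) := by
  rcases ht.1.eq_or_lt with rfl | ht0
  · rw [value_zero hC hu₀ hx]
    exact hv0 x hx
  have htI : t ∈ Ioo 0 T := ⟨ht0, ht.2⟩
  obtain ⟨i, b, hb, rfl⟩ := exists_eq_smul hx
  refine value_le_of_forall_later hC hu₀ (B := L i 0) ht.1 ht.2 hx fun t₁ ht₁ => ?_
  have ht₁0 : 0 < t₁ := ht0.trans ht₁.1
  refine hv.le_of_barrier he he_inj hL hN hk₀ hbd (J := {i}) (i := i) rfl (G := L)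
    (G' := fun j => deriv (L j)) (fun j => (hL j).hasDerivAt) (fun j => (hL j).continuous_deriv)
    (fun j _ w => by linarith [(hL j).ham_deriv_le w]) hb
    (fun j => by
      obtain ⟨C₁, -, h⟩ := (hL j).superlinear (k₀ + 1)
      exact ⟨C₁, fun w _ => h w⟩) ht0 ht₁.1 ht₁.2 (fun j hj r hr => ?_)
    (Or.inl fun j hj s hs => ?_)
  · obtain rfl : j = i := hj
    have h1 := value_segment hC hu₀ (i := j) le_rfl ht₁0 hr hb
    rw [sub_zero, value_zero hC hu₀ (smul_mem_junction j hr)] at h1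
    linarith [hv0 _ (smul_mem_junction (e := e) j hr)]
  · obtain rfl : j = i := hj
    have h1 := value_segment hC hu₀ (i := j) hs.1.le hs.2 le_rfl hb
    rw [sub_zero, zero_smul] at h1
    linarith [hv.value_le_junction he he_inj hC hu₀ hL hN hk₀ hbd hv0
      ⟨hs.1, hs.2.trans ht₁.2⟩]

end Comparison

/-! ### Semicontinuous envelopes and uniform constants -/

section Envelopes

variable {e : Fin N → Plane} {T : ℝ} {u U : ℝ × Plane → ℝ}

theorem isUpperEnvelope_of_continuousOn (hu : ContinuousOn u (cyl e T)) :
    IsUpperEnvelope e T u u := fun P hP => by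
  have : (𝓝[cyl e T] P).NeBot := mem_closure_iff_nhdsWithin_neBot.1 (subset_closure hP)
  exact ((continuous_coe_real_ereal.tendsto _).comp (hu P hP)).limsup_eq.symm

theorem isLowerEnvelope_of_continuousOn (hu : ContinuousOn u (cyl e T)) :
    IsLowerEnvelope e T u u := fun P hP => by
  have : (𝓝[cyl e T] P).NeBot := mem_closure_iff_nhdsWithin_neBot.1 (subset_closure hP)
  exact ((continuous_coe_real_ereal.tendsto _).comp (hu P hP)).liminf_eq.symm

theorem IsUpperEnvelope.le (h : IsUpperEnvelope e T u U) {P : ℝ × Plane} (hP : P ∈ cyl e T) :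
    u P ≤ U P := by
  rw [← EReal.coe_le_coe_iff, h P hP]
  refine le_limsup_of_frequently_le ?_
  intro hf
  exact (hf.self_of_nhdsWithin hP) le_rfl

theorem IsLowerEnvelope.le (h : IsLowerEnvelope e T u U) {P : ℝ × Plane} (hP : P ∈ cyl e T) :
    U P ≤ u P := by
  rw [← EReal.coe_le_coe_iff, h P hP]
  refine liminf_le_of_frequently_le ?_
  intro hf
  exact (hf.self_of_nhdsWithin hP) le_rfl

theorem IsLowerEnvelope.le_of_continuous (h : IsLowerEnvelope e T u U) {g : ℝ × Plane → ℝ}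
    (hg : Continuous g) (hgu : ∀ P ∈ cyl e T, g P ≤ u P) {P : ℝ × Plane} (hP : P ∈ cyl e T) :
    g P ≤ U P := by
  rw [← EReal.coe_le_coe_iff, h P hP, isLowerEnvelope_of_continuousOn hg.continuousOn P hP]
  exact liminf_le_liminf
    (eventually_nhdsWithin_of_forall fun Q hQ => EReal.coe_le_coe_iff.2 (hgu Q hQ))

end Envelopes

theorem exists_speed_constant {L : Fin N → ℝ → ℝ} (hL : ∀ i, IsLagrangian (L i)) (K : ℝ) :
    ∃ C, 0 < C ∧ (∀ i q, K * |q| ≤ L i q + C) ∧ ∀ i q, |q| ≤ 1 → L i q ≤ C := by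
  choose A _ hA using fun i => (hL i).superlinear K
  have h2 : ∀ i, ∃ B, ∀ q ∈ Icc (-1 : ℝ) 1, L i q ≤ B := fun i => by
    obtain ⟨B, hB⟩ := isCompact_Icc.bddAbove_image (f := L i) (K := Icc (-1 : ℝ) 1)
      (hL i).contDiff.continuous.continuousOn
    exact ⟨B, fun q hq => hB (mem_image_of_mem _ hq)⟩
  choose B hB using h2
  obtain ⟨A', hA'⟩ := (finite_range A).bddAbove
  obtain ⟨B', hB'⟩ := (finite_range B).bddAbove
  have h1 := le_abs_self A'
  have h3 := le_abs_self B'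
  have h4 := abs_nonneg A'
  have h5 := abs_nonneg B'
  refine ⟨|A'| + |B'| + 1, by positivity, fun i q => ?_, fun i q hq => ?_⟩
  · linarith [hA i q, hA' ⟨i, rfl⟩]
  · linarith [hB i q (abs_le.1 hq), hB' ⟨i, rfl⟩]

end Junction

/-! ### Existence, uniqueness and Lipschitz regularity -/

theorem theorem1p1 (N : ℕ) (hN : 1 ≤ N)
    (e : Fin N → Junction.Plane) (he : ∀ i, ‖e i‖ = 1) (he_inj : Function.Injective e)
    (L : Fin N → ℝ → ℝ) (hL : ∀ i, ContDiff ℝ 2 (L i))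
    (hconv : ∃ γ : ℝ, 0 < γ ∧ ∀ i q, γ ≤ deriv (deriv (L i)) q)
    (u₀ : Junction.Plane → ℝ)
    (hu₀ : ∃ K : ℝ, ∀ x ∈ Junction.junction e, ∀ y ∈ Junction.junction e,
      |u₀ x - u₀ y| ≤ K * Junction.geodDist e x y)
    (T : ℝ) (hT : 0 < T) :
    ∃ u : ℝ × Junction.Plane → ℝ,
      (Junction.IsViscositySolution e L T u₀ u ∧ Junction.AtBoundedDistance e T u₀ u) ∧
      (∀ v : ℝ × Junction.Plane → ℝ,
        Junction.IsViscositySolution e L T u₀ v → Junction.AtBoundedDistance e T u₀ v →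
          Set.EqOn v u (Junction.cyl e T)) ∧
      ∃ K : ℝ, ∀ t ∈ Set.Ioo 0 T, ∀ s ∈ Set.Ioo 0 T,
        ∀ x ∈ Junction.junction e, ∀ y ∈ Junction.junction e,
          |u (t, x) - u (s, y)| ≤ K * (|t - s| + Junction.geodDist e x y) := by
  obtain ⟨γ, hγ, hconv⟩ := hconv
  have hLag : ∀ i, Junction.IsLagrangian (L i) := fun i =>
    Junction.isLagrangian_of_le_deriv_deriv (hL i) hγ (hconv i)
  obtain ⟨K, hK0, hK⟩ : ∃ K : ℝ, 0 ≤ K ∧ ∀ i r r', 0 ≤ r → 0 ≤ r' →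
      |u₀ (r • e i) - u₀ (r' • e i)| ≤ K * |r - r'| := by
    obtain ⟨K, hK⟩ := hu₀
    refine ⟨max K 0, le_max_right _ _, fun i r r' hr hr' => ?_⟩
    have h := hK _ (Junction.smul_mem_junction i hr) _ (Junction.smul_mem_junction i hr')
    rw [Junction.geodDist, if_pos ⟨i, Junction.smul_mem_branch i hr,
      Junction.smul_mem_branch i hr'⟩, ← sub_smul, norm_smul, he, mul_one, Real.norm_eq_abs] at h
    exact h.trans (mul_le_mul_of_nonneg_right (le_max_left _ _) (abs_nonneg _))
  obtain ⟨C, hC0, hC, hC1⟩ := Junction.exists_speed_constant hLag K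
  have hcont := Junction.continuousOn_value he hC0.le hC hK hC1 hK0 T
  have hsub : Junction.IsSubsolution e L T (Junction.value e L u₀) :=
    Junction.isSubsolution_of_segment hN hcont.upperSemicontinuousOn
      fun i s t r r' hs hst hr hr' => Junction.value_segment hC hK hs.le hst hr hr'
  have hsuper : Junction.IsSupersolution e L T (Junction.value e L u₀) :=
    Junction.isSupersolution_value he he_inj hC hK hLag hN hcont.lowerSemicontinuousOn
  have hzero : ∀ x ∈ Junction.junction e, Junction.value e L u₀ (0, x) = u₀ x :=
    fun x hx => Junction.value_zero hC hK hx
  refine ⟨Junction.value e L u₀, ⟨⟨⟨_, Junction.isUpperEnvelope_of_continuousOn hcont, hsub,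
    fun x hx => (hzero x hx).le⟩, _, Junction.isLowerEnvelope_of_continuousOn hcont, hsuper,
    fun x hx => (hzero x hx).ge⟩, C * T, mul_pos hC0 hT, fun t ht x hx => ?_⟩, ?_,
    K + 2 * C, fun t ht s hs x hx y hy =>
      Junction.abs_value_sub_le_geodDist he hC0.le hC hK hC1 hK0 hs.1.le ht.1.le hx hy⟩
  · have h1 := Junction.initial_sub_le_value hC hK ht.1.le hx
    have h2 := Junction.value_le_initial_add hC hK hC1 ht.1.le hx
    have h3 : C * t ≤ C * T := mul_le_mul_of_nonneg_left ht.2.le hC0.le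
    rw [abs_le]
    constructor <;> linarith
  · rintro v ⟨⟨U, hU, hUsub, hU0⟩, V, hV, hVsuper, hV0⟩ ⟨D, hD0, hD⟩ ⟨t, x⟩ ⟨ht, hx⟩
    -- The chain is `v ≤ U ≤ value ≤ V ≤ v`.
    refine le_antisymm ((hU.le ⟨ht, hx⟩).trans ?_) (le_trans ?_ (hV.le ⟨ht, hx⟩))
    · exact Junction.le_value ht.1 hx fun c hc =>
        hUsub.le_of_reach he he_inj hLag hN hU0 hc ht.2
    -- Bounded distance to `u₀` is assumed only for positive times; at time `0` the bound comes from
    -- `u₀ ≤ V ≤ v`. Being continuous, it passes to the envelope `V`.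
    · have hlow : ∀ P ∈ Junction.cyl e T, -(K * ‖P.2‖) - (|u₀ 0| + D) ≤ v P := by
        rintro ⟨s, y⟩ ⟨hs, hy⟩
        obtain ⟨i, r, hr, rfl⟩ := Junction.exists_eq_smul hy
        have h1 := (abs_le.1 (hK i r 0 hr le_rfl)).1
        rw [zero_smul, sub_zero, abs_of_nonneg hr] at h1
        have h2 := neg_abs_le (u₀ 0)
        simp only [Junction.norm_smul_unit he i hr]
        rcases hs.1.eq_or_lt with h0 | h0
        · subst h0
          linarith [hV0 _ hy, hV.le ⟨hs, hy⟩]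
        · linarith [(abs_le.1 (hD s ⟨h0, hs.2⟩ _ hy)).1]
      have hbd := fun P hP => hV.le_of_continuous
        (g := fun P => -(K * ‖P.2‖) - (|u₀ 0| + D)) (by fun_prop) hlow (P := P) hP
      refine hVsuper.value_le he he_inj hC hK hLag hN hK0 (C₀ := |u₀ 0| + D)
        (fun j s r hs hr => ?_) hV0 ht hx
      have := hbd (s, r • e j) ⟨hs, Junction.smul_mem_junction j hr⟩
      simpa only [Junction.norm_smul_unit he j hr] using this
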